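/- Let $0\le\Omega<1$, $g\ge 0$ and $\lambda\in\mathbb R$. On $L^2(\mathbb R^2;\mathbb C)$ consider $A_\Omega=-\tfrac12\Delta+\tfrac12|x|^2-\Omega L_z$ with $L_z=i(x_1\partial_2-x_2\partial_1)$, understood through its quadratic form $$\langle\psi,A_\Omega\psi\rangle=\int_{\mathbb R^2}\Big(\tfrac12|\nabla\psi|^2+\tfrac12|x|^2|\psi|^2-\Omega\,\mathrm{Re}\,(\bar\psi L_z\psi)\Big)\,dx=:\|\psi\|_\Omega^2$$ (weak derivatives), whose form domain $H_\Omega$ consists of all $\psi\in L^2$ that have weak first partial derivatives and for which this integral is finite (the integrand is nonnegative). Let $\mu_{\min}=\inf\{\langle\psi,A_\Omega\psi\rangle:\psi\in H_\Omega,\ \|\psi\|_2=1\}$ be the largest lower bound of $A_\Omega$, and let $$F(\psi)=\langle\psi,A_\Omega\psi\rangle+\frac g2\|\psi\|_4^4+\frac12\big(\|\psi\|_2^2-\lambda\big)^2 .$$ Then $\mu_{\min}>0$ and $A_\Omega\ge\mu_{\min}$, that is, $\mu_{\min}\|\psi\|_2^2\le\langle\psi,A_\Omega\psi\rangle$ for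 all $\psi\in H_\Omega$; moreover $H_\Omega\subset L^4$, so that $F$ is finite on $H_\Omega$, and $F$ has at least one absolute minimizer on $H_\Omega$. If $\lambda>\mu_{\min}$, then every absolute minimizer $\psi$ of $F$ on $H_\Omega$ satisfies $$0<\|\psi\|_\Omega^2\le\lambda\|\psi\|_2^2\le\lambda(\lambda-\mu_{\min}),$$ so the trivial state $\psi=0$ is not a minimizer. -/

import Mathlib

open MeasureTheory Set
open scoped ContDiff ComplexConjugate

namespace RotatingBEC

/-- The plane, with its Euclidean norm and Lebesgue measure. The coordinates `x₁, x₂` are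
`x 0, x 1`. -/
abbrev Plane : Type := EuclideanSpace ℝ (Fin 2)

/-- The `i`-th standard basis vector of the plane. -/
noncomputable def basisVec (i : Fin 2) : Plane := EuclideanSpace.single i (1 : ℝ)

/-- `g` is the weak partial derivative of `ψ` in the `i`-th coordinate direction: `g` is locally
integrable, and `∫ (∂ᵢ φ) ψ = - ∫ φ g` for all smooth compactly supported test functions `φ`. -/
def HasWeakPartial (i : Fin 2) (ψ g : Plane → ℂ) : Prop :=
  LocallyIntegrable g ∧
    ∀ φ : Plane → ℝ, ContDiff ℝ ∞ φ → HasCompactSupport φ →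
      ∫ x, fderiv ℝ φ x (basisVec i) • ψ x = - ∫ x, φ x • g x

open Classical in
/-- The weak partial derivative `∂ᵢ ψ` (unique almost everywhere), and `0` if there is none. -/
noncomputable def weakPartial (i : Fin 2) (ψ : Plane → ℂ) : Plane → ℂ :=
  if h : ∃ g, HasWeakPartial i ψ g then h.choose else 0

/-- The angular momentum operator `L_z ψ = i (x₁ ∂₂ ψ - x₂ ∂₁ ψ)`. -/
noncomputable def angularMomentum (ψ : Plane → ℂ) (x : Plane) : ℂ :=
  Complex.I * ((x 0 : ℂ) * weakPartial 1 ψ x - (x 1 : ℂ) * weakPartial 0 ψ x)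

/-- The density of the quadratic form `⟨ψ, A_Ω ψ⟩` of
`A_Ω = -½ Δ + ½ |x|² - Ω L_z`, the Laplacian being integrated by parts:
`½ |∇ψ|² + ½ |x|² |ψ|² - Ω Re (ψ̄ L_z ψ)`. Since `L_z` is symmetric, taking the real part does
not change the integral. -/
noncomputable def energyDensity (Ω : ℝ) (ψ : Plane → ℂ) (x : Plane) : ℝ :=
  (1 / 2) * (‖weakPartial 0 ψ x‖ ^ 2 + ‖weakPartial 1 ψ x‖ ^ 2)
    + (1 / 2) * ‖x‖ ^ 2 * ‖ψ x‖ ^ 2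
    - Ω * (conj (ψ x) * angularMomentum ψ x).re

/-- The form domain `H_Ω` of `A_Ω` in `L²`: the square integrable functions that have weak first
partial derivatives and for which `⟨ψ, A_Ω ψ⟩` is finite. (For `|Ω| ≤ 1` the density is
nonnegative, so that integrability says that its integral is finite.) -/
def formDomain (Ω : ℝ) : Set (Plane → ℂ) :=
  {ψ | MemLp ψ 2 ∧ (∀ i, ∃ g, HasWeakPartial i ψ g) ∧ Integrable (energyDensity Ω ψ)}

/-- The norm `‖ψ‖_Ω = ⟨ψ, A_Ω ψ⟩ ^ (1/2)`. -/
noncomputable def omegaNorm (Ω : ℝ) (ψ : Plane → ℂ) : ℝ :=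
  Real.sqrt (∫ x, energyDensity Ω ψ x)

/-- `μ_min`, the largest lower bound of `A_Ω` (the bottom of its spectrum): the infimum of
`⟨ψ, A_Ω ψ⟩` over the `L²`-normalized `ψ` in the form domain. -/
noncomputable def muMin (Ω : ℝ) : ℝ :=
  sInf {r : ℝ | ∃ ψ ∈ formDomain Ω, lpNorm ψ 2 volume = 1 ∧ r = ∫ x, energyDensity Ω ψ x}

/-- The free energy
`F(ψ) = ⟨ψ, A_Ω ψ⟩ + (g/2) ‖ψ‖₄⁴ + ½ (‖ψ‖₂² - lam)²`. -/
noncomputable def freeEnergy (Ω g lam : ℝ) (ψ : Plane → ℂ) : ℝ :=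
  (∫ x, energyDensity Ω ψ x) + g / 2 * lpNorm ψ 4 volume ^ 4
    + (1 / 2) * (lpNorm ψ 2 volume ^ 2 - lam) ^ 2

end RotatingBEC

/-! The proof is the direct method in the calculus of variations. Completing squares writes the
energy density as `½|D₀ψ|² + ½|D₁ψ|² + ½(1 - Ω²)|x|²|ψ|²` with covariant derivatives linear in `ψ`
(`energyDensity_eq`). For `0 ≤ Ω < 1` it also dominates a multiple of `|∇ψ|² + |x|²|ψ|²`, so the
form domain is one weighted Sobolev space, the same for every `Ω` (`mem_formDomain_iff`).
Ladyzhenskaya's inequality puts this space in `L⁴`.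

A bound on the gradient and on the moment `∫|x|²|ψ|²` gives compactness in `L²`: the gradient
controls the mollification error, the moment controls the tail. The energy, a nonnegative
combination of squared norms, is weakly lower semicontinuous. Together these give
`exists_subseq_tendsto`, which serves both minimization problems. Strong `L²` convergence preserves
the constraint `‖ψ‖₂ = 1`, so `μ_min` is attained; it is positive because zero energy forces `xψ =
0`. For `F`, the penalty term passes to the limit, and Fatou handles the quartic term.

Write `E`, `Q`, `N` for the energy, `‖ψ‖₄⁴` and `‖ψ‖₂²` of a minimizer. Stationarity along the ray
`tψ` gives `E + gQ + (N - λ)N = 0`. With `Q ≥ 0` and `E ≥ μ_min N`, this yields `E ≤ λN` and `N ≤ λ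
- μ_min`. A small multiple of a ground state has free energy below `λ²/2`, which excludes the
trivial state. -/

namespace RotatingBEC

open Filter Topology
open scoped ENNReal Convolution

/-! ### Integral inequalities: Cauchy–Schwarz, Fatou, Minkowski -/

section General

variable {α : Type*} [MeasurableSpace α] {μ : Measure α}

lemma sq_lintegral_mul_le {f g : α → ℝ≥0∞} (hf : AEMeasurable f μ) (hg : AEMeasurable g μ) :
    (∫⁻ x, f x * g x ∂μ) ^ 2 ≤ (∫⁻ x, f x ^ 2 ∂μ) * ∫⁻ x, g x ^ 2 ∂μ := by
  have h := ENNReal.lintegral_mul_le_Lp_mul_Lq μ Real.HolderConjugate.two_two hf hg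
  have h2 := pow_le_pow_left₀ (zero_le) h 2
  simp only [Pi.mul_apply, mul_pow, ← ENNReal.rpow_natCast, ← ENNReal.rpow_mul] at h2
  norm_num at h2 ⊢
  exact h2

lemma memLp_two_iff {E : Type*} [NormedAddCommGroup E] {f : α → E} :
    MemLp f 2 μ ↔ AEStronglyMeasurable f μ ∧ ∫⁻ x, ‖f x‖ₑ ^ 2 ∂μ < ⊤ := by
  refine and_congr_right fun _ => ?_
  rw [eLpNorm_lt_top_iff_lintegral_rpow_enorm_lt_top (by norm_num) (by norm_num)]
  norm_num

lemma memLp_four_iff {E : Type*} [NormedAddCommGroup E] {f : α → E} :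
    MemLp f 4 μ ↔ AEStronglyMeasurable f μ ∧ ∫⁻ x, ‖f x‖ₑ ^ 4 ∂μ < ⊤ := by
  refine and_congr_right fun _ => ?_
  rw [eLpNorm_lt_top_iff_lintegral_rpow_enorm_lt_top (by norm_num) (by norm_num)]
  norm_num

lemma lintegral_pow_enorm_le_liminf {E : Type*} [NormedAddCommGroup E] {f : ℕ → α → E} {g : α → E}
    (hf : ∀ n, AEStronglyMeasurable (f n) μ)
    (hfg : ∀ᵐ x ∂μ, Tendsto (fun n => f n x) atTop (𝓝 (g x))) (p : ℕ) :
    ∫⁻ x, ‖g x‖ₑ ^ p ∂μ ≤ liminf (fun n => ∫⁻ x, ‖f n x‖ₑ ^ p ∂μ) atTop := by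
  refine le_trans (le_of_eq (lintegral_congr_ae ?_))
    (lintegral_liminf_le' fun n => (hf n).enorm.pow_const p)
  filter_upwards [hfg] with x hx
  exact (((ENNReal.continuous_pow p).tendsto _).comp hx.enorm).liminf_eq.symm

lemma lintegral_pow_enorm_le_of_tendsto {E : Type*} [NormedAddCommGroup E] {f : ℕ → α → E}
    {g : α → E} (hf : ∀ n, AEStronglyMeasurable (f n) μ)
    (hfg : ∀ᵐ x ∂μ, Tendsto (fun n => f n x) atTop (𝓝 (g x))) (p : ℕ) {C : ℝ≥0∞}
    (hC : ∀ n, ∫⁻ x, ‖f n x‖ₑ ^ p ∂μ ≤ C) : ∫⁻ x, ‖g x‖ₑ ^ p ∂μ ≤ C :=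
  (lintegral_pow_enorm_le_liminf hf hfg p).trans
    (liminf_le_of_le (by isBoundedDefault) fun b hb => by
      obtain ⟨n, hn⟩ := hb.exists
      exact hn.trans (hC n))

lemma sq_enorm_integral_le {E : Type*} [NormedAddCommGroup E] [NormedSpace ℝ E]
    [IsProbabilityMeasure μ] {f : α → E} (hf : AEStronglyMeasurable f μ) :
    ‖∫ x, f x ∂μ‖ₑ ^ 2 ≤ ∫⁻ x, ‖f x‖ₑ ^ 2 ∂μ := by
  have h := sq_lintegral_mul_le (μ := μ) hf.enorm (aemeasurable_const (b := (1 : ℝ≥0∞)))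
  simp only [mul_one, one_pow, lintegral_const, measure_univ] at h
  exact (pow_le_pow_left₀ zero_le (enorm_integral_le_lintegral_enorm f) 2).trans h

/-- Minkowski's inequality in `L²`, for averages over a probability measure. -/
lemma lintegral_sq_enorm_integral_le {β E : Type*} [MeasurableSpace β] {ν : Measure β}
    [NormedAddCommGroup E] [NormedSpace ℝ E] [SFinite μ] [IsProbabilityMeasure ν]
    {F : β → α → E} (hF : AEStronglyMeasurable (Function.uncurry F) (ν.prod μ)) :
    ∫⁻ x, ‖∫ t, F t x ∂ν‖ₑ ^ 2 ∂μ ≤ ∫⁻ t, ∫⁻ x, ‖F t x‖ₑ ^ 2 ∂μ ∂ν := by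
  rw [lintegral_lintegral_swap (f := fun t x => ‖F t x‖ₑ ^ 2) (hF.enorm.pow_const 2)]
  refine lintegral_mono_ae ?_
  filter_upwards [hF.prod_swap.prodMk_left] with x hx
  exact sq_enorm_integral_le hx

end General

/-! ### Translations and mollification -/

lemma enorm_fderiv_sq_le (u : Plane → ℂ) (x : Plane) :
    ‖fderiv ℝ u x‖ₑ ^ 2 ≤ ‖fderiv ℝ u x (basisVec 0)‖ₑ ^ 2 + ‖fderiv ℝ u x (basisVec 1)‖ₑ ^ 2 := by
  set L := fderiv ℝ u x
  have hb : ‖L‖ ≤ Real.sqrt (‖L (basisVec 0)‖ ^ 2 + ‖L (basisVec 1)‖ ^ 2) := by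
    refine L.opNorm_le_bound (Real.sqrt_nonneg _) fun y => ?_
    have hy : y = y 0 • basisVec 0 + y 1 • basisVec 1 := by
      ext i; fin_cases i <;> simp [basisVec]
    have h1 : ‖L y‖ ≤ |y 0| * ‖L (basisVec 0)‖ + |y 1| * ‖L (basisVec 1)‖ := by
      conv_lhs => rw [hy]
      rw [map_add, map_smul, map_smul]
      refine (norm_add_le _ _).trans (by simp)
    refine h1.trans ((pow_le_pow_iff_left₀ (by positivity) (by positivity) two_ne_zero).1 ?_)
    rw [mul_pow, Real.sq_sqrt (by positivity), EuclideanSpace.norm_sq_eq, Fin.sum_univ_two]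
    simp only [Real.norm_eq_abs]
    nlinarith [sq_nonneg (|y 0| * ‖L (basisVec 1)‖ - |y 1| * ‖L (basisVec 0)‖)]
  have h2 : ‖L‖ ^ 2 ≤ ‖L (basisVec 0)‖ ^ 2 + ‖L (basisVec 1)‖ ^ 2 := by
    have := pow_le_pow_left₀ (norm_nonneg _) hb 2
    rwa [Real.sq_sqrt (by positivity)] at this
  rw [← ofReal_norm, ← ofReal_norm, ← ofReal_norm, ← ENNReal.ofReal_pow (norm_nonneg _),
    ← ENNReal.ofReal_pow (norm_nonneg _), ← ENNReal.ofReal_pow (norm_nonneg _),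
    ← ENNReal.ofReal_add (by positivity) (by positivity)]
  exact ENNReal.ofReal_le_ofReal h2

/-- The increment is the average over `s ∈ (0, 1]` of the derivative at `x + s • y` in direction
`y`; Minkowski's inequality and translation invariance finish. -/
lemma lintegral_sq_enorm_translate_sub_le_of_contDiff {u : Plane → ℂ} (hu : ContDiff ℝ 1 u)
    (y : Plane) :
    ∫⁻ x, ‖u (x + y) - u x‖ₑ ^ 2 ≤ ‖y‖ₑ ^ 2 * ∫⁻ x, ‖fderiv ℝ u x‖ₑ ^ 2 := by
  have hc : Continuous (fderiv ℝ u) := hu.continuous_fderiv one_ne_zero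
  let ν : Measure ℝ := volume.restrict (Ioc 0 1)
  have : IsProbabilityMeasure ν := ⟨by simp [ν]⟩
  have key : ∀ x, u (x + y) - u x = ∫ s, fderiv ℝ u (x + s • y) y ∂ν := by
    intro x
    have h : ∀ s ∈ uIcc (0 : ℝ) 1,
        HasDerivAt (fun s : ℝ => u (x + s • y)) (fderiv ℝ u (x + s • y) y) s := by
      intro s _
      have h1 : HasDerivAt (fun s : ℝ => x + s • y) y s := by
        simpa using ((hasDerivAt_id s).smul_const y).const_add x
      exact ((hu.differentiable one_ne_zero) _).hasFDerivAt.comp_hasDerivAt s h1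
    have h2 := intervalIntegral.integral_eq_sub_of_hasDerivAt h
      (Continuous.intervalIntegrable (by fun_prop) _ _)
    rw [intervalIntegral.integral_of_le zero_le_one] at h2
    simpa using h2.symm
  simp_rw [key]
  refine (lintegral_sq_enorm_integral_le (Continuous.aestronglyMeasurable (by
    unfold Function.uncurry; fun_prop))).trans ?_
  calc _ ≤ ∫⁻ s, ‖y‖ₑ ^ 2 * (∫⁻ x, ‖fderiv ℝ u x‖ₑ ^ 2) ∂ν := by
        refine lintegral_mono fun s => ?_
        rw [← lintegral_add_right_eq_self (fun x => ‖fderiv ℝ u x‖ₑ ^ 2) (s • y),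
          ← lintegral_const_mul' _ _ (by simp)]
        refine lintegral_mono fun x => ?_
        rw [← mul_pow, mul_comm]
        exact pow_le_pow_left₀ zero_le (ContinuousLinearMap.le_opENorm _ _) 2
    _ = _ := by simp

/-- The standard mollifier, supported in the ball of radius `2 * ε`. -/
noncomputable def bump (ε : ℝ) (hε : 0 < ε) : ContDiffBump (0 : Plane) :=
  ⟨ε, 2 * ε, hε, by linarith⟩

/-- The mollification of `ψ` at scale `ε`. -/
noncomputable def mollify (ε : ℝ) (hε : 0 < ε) (ψ : Plane → ℂ) : Plane → ℂ :=
  (bump ε hε).normed volume ⋆[ContinuousLinearMap.lsmul ℝ ℝ, volume] ψ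

section

variable {ε : ℝ} (hε : 0 < ε)

lemma contDiff_mollify {ψ : Plane → ℂ} (hψ : LocallyIntegrable ψ) :
    ContDiff ℝ 1 (mollify ε hε ψ) :=
  (bump ε hε).hasCompactSupport_normed.contDiff_convolution_left (n := 1) _
    (bump ε hε).contDiff_normed hψ

/-- Testing the weak derivative with `t ↦ k (x - t)` works because the sign from the reflection
cancels the sign from integration by parts. -/
lemma fderiv_mollify {ψ g : Plane → ℂ} (hψ : LocallyIntegrable ψ) {i : Fin 2}
    (h : HasWeakPartial i ψ g) (x : Plane) :
    fderiv ℝ (mollify ε hε ψ) x (basisVec i) = mollify ε hε g x := by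
  set k := (bump ε hε).normed (volume : Measure Plane)
  have hk : ContDiff ℝ ∞ k := (bump ε hε).contDiff_normed
  have hks : HasCompactSupport k := (bump ε hε).hasCompactSupport_normed
  have h1 := (hks.hasFDerivAt_convolution_left (ContinuousLinearMap.lsmul ℝ ℝ) (hk.of_le (by simp))
    hψ x).fderiv
  have hce := (hks.fderiv ℝ).convolutionExists_left
    ((ContinuousLinearMap.lsmul ℝ ℝ).precompL Plane) (hk.continuous_fderiv (by simp)) hψ x
  have hsmooth : ContDiff ℝ ∞ fun t => k (x - t) := hk.comp (contDiff_const.sub contDiff_id)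
  have hsupp : HasCompactSupport fun t => k (x - t) :=
    hks.comp_homeomorph (Homeomorph.subLeft x)
  have h2 := h.2 _ hsmooth hsupp
  have h3 : ∀ t, fderiv ℝ (fun t => k (x - t)) t (basisVec i)
      = - fderiv ℝ k (x - t) (basisVec i) := by
    intro t
    have : HasFDerivAt (fun t => k (x - t)) ((fderiv ℝ k (x - t)).comp
        (-(ContinuousLinearMap.id ℝ Plane))) t :=
      ((hk.differentiable (by simp)) _).hasFDerivAt.comp t ((hasFDerivAt_id t).const_sub x)
    rw [this.fderiv]; simp
  simp only [h3, neg_smul, integral_neg, neg_inj] at h2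
  unfold mollify
  rw [h1, convolution_eq_swap, ContinuousLinearMap.integral_apply, convolution_eq_swap]
  · simpa using h2
  · exact hce.integrable_swap

/-- The probability measure with density the mollifier. -/
noncomputable def bumpMeasure : Measure Plane :=
  volume.withDensity fun t => ENNReal.ofReal ((bump ε hε).normed volume t)

instance : IsProbabilityMeasure (bumpMeasure hε) := by
  constructor
  rw [bumpMeasure, withDensity_apply _ MeasurableSet.univ, Measure.restrict_univ,
    ← ofReal_integral_eq_lintegral_ofReal (bump ε hε).integrable_normed
      (Eventually.of_forall (bump ε hε).nonneg_normed), (bump ε hε).integral_normed,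
    ENNReal.ofReal_one]

lemma bumpMeasure_ac : bumpMeasure hε ≪ volume := withDensity_absolutelyContinuous _ _

lemma integral_bumpMeasure (f : Plane → ℂ) :
    ∫ t, f t ∂(bumpMeasure hε) = ∫ t, (bump ε hε).normed volume t • f t := by
  rw [bumpMeasure, integral_withDensity_eq_integral_toReal_smul
    (by have := (bump ε hε).continuous_normed (μ := volume); fun_prop) (by simp)]
  simp [ENNReal.toReal_ofReal, (bump ε hε).nonneg_normed]

lemma integrable_bumpMeasure_iff {f : Plane → ℂ} :
    Integrable f (bumpMeasure hε) ↔ Integrable fun t => (bump ε hε).normed volume t • f t := by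
  rw [bumpMeasure, integrable_withDensity_iff_integrable_smul'
    (by have := (bump ε hε).continuous_normed (μ := volume); fun_prop) (by simp)]
  simp [ENNReal.toReal_ofReal, (bump ε hε).nonneg_normed]

/-- Seen as an average over a probability measure, mollification falls under Minkowski's inequality,
with constant one. -/
lemma mollify_apply (ψ : Plane → ℂ) (x : Plane) :
    mollify ε hε ψ x = ∫ t, ψ (x - t) ∂(bumpMeasure hε) := by
  rw [integral_bumpMeasure]; rfl

lemma norm_lt_of_bumpMeasure : ∀ᵐ t ∂(bumpMeasure hε), ‖t‖ₑ ≤ ENNReal.ofReal (2 * ε) := by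
  rw [bumpMeasure, ae_withDensity_iff
    (by have := (bump ε hε).continuous_normed (μ := volume); fun_prop)]
  refine Eventually.of_forall fun t ht => ?_
  have : t ∈ Function.support ((bump ε hε).normed (volume : Measure Plane)) := by
    intro h0; exact ht (by simp [h0])
  rw [ContDiffBump.support_normed_eq] at this
  rw [← ofReal_norm]
  refine ENNReal.ofReal_le_ofReal ?_
  simpa [bump] using (mem_ball_zero_iff.1 this).le

lemma aestronglyMeasurable_sub {ψ : Plane → ℂ} (hψ : AEStronglyMeasurable ψ) :
    AEStronglyMeasurable (Function.uncurry fun t x => ψ (x - t))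
      ((bumpMeasure hε).prod volume) := by
  have h : AEStronglyMeasurable (fun p : Plane × Plane => ψ (p.2 - p.1))
      ((volume : Measure Plane).prod volume) :=
    (hψ.comp_quasiMeasurePreserving
      (quasiMeasurePreserving_sub_of_right_invariant volume volume)).prod_swap
  exact h.mono_ac ((bumpMeasure_ac hε).prod Measure.AbsolutelyContinuous.rfl)

lemma lintegral_sq_enorm_mollify_le {ψ : Plane → ℂ} (hψ : AEStronglyMeasurable ψ) :
    ∫⁻ x, ‖mollify ε hε ψ x‖ₑ ^ 2 ≤ ∫⁻ x, ‖ψ x‖ₑ ^ 2 := by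
  simp_rw [mollify_apply]
  refine (lintegral_sq_enorm_integral_le (aestronglyMeasurable_sub hε hψ)).trans ?_
  simp_rw [lintegral_sub_right_eq_self (fun x => ‖ψ x‖ₑ ^ 2), lintegral_const, measure_univ,
    mul_one, le_refl]

end

/-- Lebesgue differentiation: the outer and inner radii of the bumps keep the fixed ratio `2`. The
scales are chosen before the function. -/
lemma exists_mollify_tendsto : ∃ (e : ℕ → ℝ) (he : ∀ n, 0 < e n), ∀ ψ : Plane → ℂ,
    LocallyIntegrable ψ → ∀ᵐ x, Tendsto (fun n => mollify (e n) (he n) ψ x) atTop (𝓝 (ψ x)) := by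
  refine ⟨fun n => 1 / ((n : ℝ) + 1), fun n => by positivity, fun ψ hψ => ?_⟩
  refine ContDiffBump.ae_convolution_tendsto_right_of_locallyIntegrable (K := 2)
    (φ := fun n : ℕ => bump (1 / ((n : ℝ) + 1)) (by positivity)) ?_ ?_ hψ
  · simpa [bump] using (tendsto_one_div_add_atTop_nhds_zero_nat (𝕜 := ℝ)).const_mul 2
  · exact Eventually.of_forall fun n => le_rfl

/-- The `C¹` estimate holds for every mollification, with a bound that does not depend on the scale;
Fatou carries it to `ψ`. -/
lemma lintegral_sq_enorm_translate_sub_le {ψ g₀ g₁ : Plane → ℂ} (hψ : LocallyIntegrable ψ)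
    (h₀ : HasWeakPartial 0 ψ g₀) (h₁ : HasWeakPartial 1 ψ g₁) (y : Plane) :
    ∫⁻ x, ‖ψ (x + y) - ψ x‖ₑ ^ 2
      ≤ ‖y‖ₑ ^ 2 * ((∫⁻ x, ‖g₀ x‖ₑ ^ 2) + ∫⁻ x, ‖g₁ x‖ₑ ^ 2) := by
  obtain ⟨e, he, hlim⟩ := exists_mollify_tendsto
  have hc : ∀ n, Continuous (mollify (e n) (he n) ψ) := fun n =>
    (contDiff_mollify (he n) hψ).continuous
  refine lintegral_pow_enorm_le_of_tendsto
    (f := fun n x => mollify (e n) (he n) ψ (x + y) - mollify (e n) (he n) ψ x)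
    (fun n => Continuous.aestronglyMeasurable (by have := hc n; fun_prop)) ?_ 2 fun n => ?_
  · filter_upwards [hlim ψ hψ, (quasiMeasurePreserving_add_right volume y).ae (hlim ψ hψ)]
      with x hx hx' using hx'.sub hx
  · refine (lintegral_sq_enorm_translate_sub_le_of_contDiff
      (contDiff_mollify (he n) hψ) y).trans ?_
    gcongr
    calc _ ≤ ∫⁻ x, (‖mollify (e n) (he n) g₀ x‖ₑ ^ 2 + ‖mollify (e n) (he n) g₁ x‖ₑ ^ 2) := by
          refine lintegral_mono fun x => ?_
          rw [← fderiv_mollify (he n) hψ h₀, ← fderiv_mollify (he n) hψ h₁]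
          exact enorm_fderiv_sq_le _ _
      _ ≤ _ := by
          rw [lintegral_add_left
            ((contDiff_mollify (he n) h₀.1).continuous.enorm.measurable.pow_const 2)]
          exact add_le_add (lintegral_sq_enorm_mollify_le _ h₀.1.aestronglyMeasurable)
            (lintegral_sq_enorm_mollify_le _ h₁.1.aestronglyMeasurable)

/-- The error is an average of the increments `ψ(x - t) - ψ(x)` over `|t| ≤ 2ε`, each controlled by
the translation estimate. -/
lemma lintegral_sq_enorm_mollify_sub_le {ε : ℝ} (hε : 0 < ε) {ψ g₀ g₁ : Plane → ℂ}
    (hψ : LocallyIntegrable ψ)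
    (h₀ : HasWeakPartial 0 ψ g₀) (h₁ : HasWeakPartial 1 ψ g₁) :
    ∫⁻ x, ‖mollify ε hε ψ x - ψ x‖ₑ ^ 2
      ≤ ENNReal.ofReal (2 * ε) ^ 2 * ((∫⁻ x, ‖g₀ x‖ₑ ^ 2) + ∫⁻ x, ‖g₁ x‖ₑ ^ 2) := by
  have hint : ∀ x, Integrable (fun t => ψ (x - t)) (bumpMeasure hε) := fun x =>
    (integrable_bumpMeasure_iff hε).2
      ((bump ε hε).hasCompactSupport_normed.convolutionExists_left
        (ContinuousLinearMap.lsmul ℝ ℝ) (bump ε hε).continuous_normed hψ x)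
  have hrw : ∀ x, mollify ε hε ψ x - ψ x = ∫ t, (ψ (x - t) - ψ x) ∂(bumpMeasure hε) := by
    intro x
    rw [integral_sub (hint x) (integrable_const _), mollify_apply]; simp
  simp_rw [hrw]
  have hm : AEStronglyMeasurable (Function.uncurry fun t x => ψ (x - t) - ψ x)
      ((bumpMeasure hε).prod volume) :=
    (aestronglyMeasurable_sub hε hψ.aestronglyMeasurable).sub
      hψ.aestronglyMeasurable.comp_snd
  refine (lintegral_sq_enorm_integral_le hm).trans ?_
  refine (lintegral_mono_ae (g := fun _ => ENNReal.ofReal (2 * ε) ^ 2 *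
    ((∫⁻ x, ‖g₀ x‖ₑ ^ 2) + ∫⁻ x, ‖g₁ x‖ₑ ^ 2)) ?_).trans (by simp)
  filter_upwards [norm_lt_of_bumpMeasure hε] with t ht
  have := lintegral_sq_enorm_translate_sub_le hψ h₀ h₁ (-t)
  simp only [← sub_eq_add_neg, enorm_neg] at this
  exact this.trans (by gcongr)

/-! ### The embedding into `L⁴` -/

lemma ennreal_add_sq_le (a b : ℝ≥0∞) : (a + b) ^ 2 ≤ 2 * a ^ 2 + 2 * b ^ 2 := by
  have h := ENNReal.rpow_add_le_mul_rpow_add_rpow a b (p := 2) one_le_two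
  norm_num at h
  rwa [mul_add] at h

lemma enorm_add_clm_le (S T : Plane →L[ℝ] ℂ) : ‖S + T‖ₑ ≤ ‖S‖ₑ + ‖T‖ₑ := enorm_add_le S T

/-- Ladyzhenskaya's inequality. -/
lemma exists_lintegral_pow_four_le : ∃ C : ℝ≥0∞, C ≠ ⊤ ∧ ∀ v : Plane → ℂ, ContDiff ℝ 1 v →
    HasCompactSupport v → ∫⁻ x, ‖v x‖ₑ ^ 4
      ≤ C * ((∫⁻ x, ‖v x‖ₑ ^ 2) * ∫⁻ x, ‖fderiv ℝ v x‖ₑ ^ 2) := by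
  refine ⟨lintegralPowLePowLIntegralFDerivConst (volume : Measure Plane) 2 * 2 ^ 2,
    ENNReal.mul_ne_top (by simp) (by simp), fun v hv hs => ?_⟩
  -- The Gagliardo–Nirenberg–Sobolev inequality `‖u‖₂ ≤ C‖∇u‖₁` of the plane is applied to `u = v²`,
  -- whose gradient is `2v∇v`; Cauchy–Schwarz then separates the factors.
  have hs2 : HasCompactSupport fun x => v x * v x := hs.mul_right
  have h := lintegral_pow_le_pow_lintegral_fderiv (volume : Measure Plane)
    (hv.mul hv) hs2 (p := 2) (by simpa using Real.HolderConjugate.two_two)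
  norm_num at h
  have h4 : ∀ x, ‖v x‖ₑ ^ 4 = (‖v x‖ₑ * ‖v x‖ₑ) ^ 2 := fun x => by ring
  simp_rw [h4]
  refine h.trans ?_
  rw [mul_assoc]
  gcongr
  have hd : ∀ x, ‖fderiv ℝ (fun x => v x * v x) x‖ₑ ≤ 2 * (‖v x‖ₑ * ‖fderiv ℝ v x‖ₑ) := by
    intro x
    have hdv := (hv.differentiable one_ne_zero) x
    rw [fderiv_fun_mul hdv hdv]
    refine (enorm_add_clm_le _ _).trans (le_of_eq ?_)
    rw [enorm_smul]; ring
  calc _ ≤ (∫⁻ x, 2 * (‖v x‖ₑ * ‖fderiv ℝ v x‖ₑ)) ^ 2 := by gcongr with x; exact hd x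
    _ = 2 ^ 2 * (∫⁻ x, ‖v x‖ₑ * ‖fderiv ℝ v x‖ₑ) ^ 2 := by
        rw [lintegral_const_mul' _ _ (by simp), mul_pow]
    _ ≤ _ := by
        gcongr
        exact sq_lintegral_mul_le hv.continuous.enorm.aemeasurable
          (hv.continuous_fderiv one_ne_zero).enorm.aemeasurable

/-- Dilations of one bump by factors `c n ≤ 1` can only decrease its gradient, so a single `M`
serves for all `n`. -/
lemma exists_cutoff : ∃ (χ : ℕ → Plane → ℝ) (M : ℝ≥0∞), M ≠ ⊤ ∧
    (∀ n, ContDiff ℝ 1 (χ n)) ∧ (∀ n, HasCompactSupport (χ n)) ∧ (∀ n x, ‖χ n x‖ₑ ≤ 1) ∧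
    (∀ n x, ‖fderiv ℝ (χ n) x‖ₑ ≤ M) ∧ ∀ x, Tendsto (fun n => χ n x) atTop (𝓝 1) := by
  let f : ContDiffBump (0 : Plane) := ⟨1, 2, one_pos, one_lt_two⟩
  have hf : ContDiff ℝ 1 f := f.contDiff
  let c : ℕ → ℝ := fun n => 1 / ((n : ℝ) + 1)
  have hc : ∀ n, 0 < c n := fun n => by positivity
  have hc1 : ∀ n, c n ≤ 1 := fun n => by
    simp only [c]; rw [div_le_one (by positivity)]; linarith [n.cast_nonneg (α := ℝ)]
  obtain ⟨M, hM⟩ := (hf.continuous_fderiv one_ne_zero).bounded_above_of_compact_support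
    (f.hasCompactSupport.fderiv ℝ)
  refine ⟨fun n x => f (c n • x), ENNReal.ofReal M, by simp, fun n => ?_, fun n => ?_,
    fun n x => ?_, fun n x => ?_, fun x => ?_⟩
  · exact hf.comp (contDiff_const_smul _)
  · exact f.hasCompactSupport.comp_smul (hc n).ne'
  · rw [← ofReal_norm, Real.norm_of_nonneg f.nonneg, ← ENNReal.ofReal_one]
    exact ENNReal.ofReal_le_ofReal f.le_one
  · have hd : fderiv ℝ (fun x => f (c n • x)) x = c n • fderiv ℝ f (c n • x) := by
      rw [fderiv_comp_smul]
    rw [hd, ← ofReal_norm, norm_smul, Real.norm_of_nonneg (hc n).le]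
    refine ENNReal.ofReal_le_ofReal ?_
    have := hM (c n • x)
    nlinarith [hc1 n, (hc n).le, norm_nonneg (fderiv ℝ f (c n • x))]
  · have h1 : Tendsto (fun n => c n • x) atTop (𝓝 0) := by
      simpa [c] using (tendsto_one_div_add_atTop_nhds_zero_nat (𝕜 := ℝ)).smul_const x
    refine tendsto_const_nhds.congr' ?_
    filter_upwards [h1 (Metric.ball_mem_nhds 0 one_pos)] with n hn
    exact (f.one_of_mem_closedBall (Metric.ball_subset_closedBall hn)).symm

/-- Ladyzhenskaya's inequality needs `C¹` functions of compact support, so it is applied to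
truncated mollifications. Their `L²` norms and gradients are bounded uniformly, and Fatou gives the
limit. -/
lemma memLp_four_of_hasWeakPartial {ψ g₀ g₁ : Plane → ℂ} (hψ : MemLp ψ 2)
    (h₀ : HasWeakPartial 0 ψ g₀) (h₁ : HasWeakPartial 1 ψ g₁) (hg₀ : MemLp g₀ 2)
    (hg₁ : MemLp g₁ 2) : MemLp ψ 4 := by
  obtain ⟨C, hC, hlad⟩ := exists_lintegral_pow_four_le
  obtain ⟨χ, M, hM, hχ, hχs, hχ1, hχM, hχt⟩ := exists_cutoff
  obtain ⟨e, he, hlim⟩ := exists_mollify_tendsto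
  have hloc : LocallyIntegrable ψ := hψ.locallyIntegrable (by norm_num)
  obtain ⟨-, hψ2⟩ := memLp_two_iff.1 hψ
  obtain ⟨-, hg₀2⟩ := memLp_two_iff.1 hg₀
  obtain ⟨-, hg₁2⟩ := memLp_two_iff.1 hg₁
  set A := ∫⁻ x, ‖ψ x‖ₑ ^ 2
  set B₀ := ∫⁻ x, ‖g₀ x‖ₑ ^ 2
  set B₁ := ∫⁻ x, ‖g₁ x‖ₑ ^ 2
  let u : ℕ → Plane → ℂ := fun n => mollify (e n) (he n) ψ
  have hu : ∀ n, ContDiff ℝ 1 (u n) := fun n => contDiff_mollify (he n) hloc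
  have huA : ∀ n, ∫⁻ x, ‖u n x‖ₑ ^ 2 ≤ A := fun n =>
    lintegral_sq_enorm_mollify_le (he n) hψ.aestronglyMeasurable
  have hfin : C * (A * (2 * (B₀ + B₁) + 2 * (M ^ 2 * A))) < ⊤ := by
    finiteness
  refine memLp_four_iff.2 ⟨hψ.aestronglyMeasurable, lt_of_le_of_lt ?_ hfin⟩
  refine lintegral_pow_enorm_le_of_tendsto (f := fun n x => χ n x • u n x)
    (fun n => ((hχ n).smul (hu n)).continuous.aestronglyMeasurable) ?_ 4 fun n => ?_
  · filter_upwards [hlim ψ hloc] with x hx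
    simpa using (hχt x).smul hx
  · refine (hlad _ ((hχ n).smul (hu n)) ((hχs n).smul_right)).trans ?_
    gcongr C * (?_ * ?_)
    · refine le_trans (lintegral_mono fun x => ?_) (huA n)
      rw [Pi.smul_apply', enorm_smul]
      gcongr
      exact mul_le_of_le_one_left zero_le (hχ1 n x)
    · have hpt : ∀ x, ‖fderiv ℝ (fun x => χ n x • u n x) x‖ₑ ^ 2
          ≤ 2 * (‖mollify (e n) (he n) g₀ x‖ₑ ^ 2 + ‖mollify (e n) (he n) g₁ x‖ₑ ^ 2)
            + 2 * (M ^ 2 * ‖u n x‖ₑ ^ 2) := by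
        intro x
        have hd : ‖fderiv ℝ (fun x => χ n x • u n x) x‖ₑ
            ≤ ‖fderiv ℝ (u n) x‖ₑ + M * ‖u n x‖ₑ := by
          rw [fderiv_fun_smul ((hχ n).differentiable one_ne_zero x)
            ((hu n).differentiable one_ne_zero x)]
          refine (enorm_add_clm_le _ _).trans (add_le_add ?_ ?_)
          · rw [enorm_smul]; exact mul_le_of_le_one_left zero_le (hχ1 n x)
          · have : ‖(fderiv ℝ (χ n) x).smulRight (u n x)‖ₑ
                = ‖fderiv ℝ (χ n) x‖ₑ * ‖u n x‖ₑ := by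
              rw [← ofReal_norm, ContinuousLinearMap.norm_smulRight_apply,
                ENNReal.ofReal_mul (norm_nonneg _), ofReal_norm, ofReal_norm]
            rw [this]
            gcongr
            exact hχM n x
        refine (pow_le_pow_left₀ zero_le hd 2).trans ((ennreal_add_sq_le _ _).trans ?_)
        rw [mul_pow, ← fderiv_mollify (he n) hloc h₀, ← fderiv_mollify (he n) hloc h₁]
        gcongr
        exact enorm_fderiv_sq_le _ _
      refine (lintegral_mono hpt).trans ?_
      have hm₀ := (contDiff_mollify (he n) h₀.1).continuous.enorm.measurable.pow_const 2
      have hm₁ := (contDiff_mollify (he n) h₁.1).continuous.enorm.measurable.pow_const 2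
      rw [lintegral_add_left (by fun_prop), lintegral_const_mul' _ _ (by simp),
        lintegral_add_left hm₀, lintegral_const_mul' _ _ (by simp),
        lintegral_const_mul' _ _ (by finiteness)]
      gcongr
      · exact lintegral_sq_enorm_mollify_le _ h₀.1.aestronglyMeasurable
      · exact lintegral_sq_enorm_mollify_le _ h₁.1.aestronglyMeasurable
      · exact huA n

/-! ### Weak convergence and Rellich compactness -/

/-- Weak convergence in `L²`. -/
def WeakTendsto (f : ℕ → Plane → ℂ) (g : Plane → ℂ) : Prop :=
  ∀ h : Plane → ℂ, MemLp h 2 →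
    Tendsto (fun n => ∫ x, h x * f n x) atTop (𝓝 (∫ x, h x * g x))

lemma integrable_mul_of_memLp {h f : Plane → ℂ} (hh : MemLp h 2) (hf : MemLp f 2) :
    Integrable fun x => h x * f x := hh.integrable_mul hf

lemma WeakTendsto.comp {f : ℕ → Plane → ℂ} {g : Plane → ℂ} (h : WeakTendsto f g) {φ : ℕ → ℕ}
    (hφ : StrictMono φ) : WeakTendsto (fun n => f (φ n)) g :=
  fun k hk => (h k hk).comp hφ.tendsto_atTop

lemma WeakTendsto.add {f f' : ℕ → Plane → ℂ} {g g' : Plane → ℂ} (h : WeakTendsto f g)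
    (h' : WeakTendsto f' g') (hf : ∀ n, MemLp (f n) 2) (hf' : ∀ n, MemLp (f' n) 2)
    (hg : MemLp g 2) (hg' : MemLp g' 2) :
    WeakTendsto (fun n x => f n x + f' n x) (fun x => g x + g' x) := by
  intro k hk
  have e : ∀ {a b : Plane → ℂ}, MemLp a 2 → MemLp b 2 →
      ∫ x, k x * (a x + b x) = (∫ x, k x * a x) + ∫ x, k x * b x := fun ha hb => by
    simp_rw [mul_add]
    exact integral_add (integrable_mul_of_memLp hk ha) (integrable_mul_of_memLp hk hb)
  simp_rw [e (hf _) (hf' _), e hg hg']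
  exact (h k hk).add (h' k hk)

lemma WeakTendsto.const_mul {f : ℕ → Plane → ℂ} {g : Plane → ℂ} (h : WeakTendsto f g) (c : ℂ) :
    WeakTendsto (fun n x => c * f n x) (fun x => c * g x) := by
  intro k hk
  have e : ∀ a : Plane → ℂ, ∫ x, k x * (c * a x) = c * ∫ x, k x * a x := fun a => by
    rw [← integral_const_mul]; congr 1; ext x; ring
  simp_rw [e]
  exact (h k hk).const_mul c

/-- Sequential Banach–Alaoglu in the dual of `L²`, read back through Riesz. The sequence occupies
the conjugate-linear slot while `WeakTendsto` pairs without conjugation, so the functionals are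
evaluated at `conj h` and the limit is conjugated at the end. -/
lemma exists_weakTendsto_subseq {f : ℕ → Plane → ℂ} (hf : ∀ n, MemLp (f n) 2) {C : ℝ≥0∞}
    (hC : C ≠ ⊤) (hb : ∀ n, ∫⁻ x, ‖f n x‖ₑ ^ 2 ≤ C) :
    ∃ φ : ℕ → ℕ, StrictMono φ ∧ ∃ g, MemLp g 2 ∧ WeakTendsto (fun n => f (φ n)) g := by
  have : Fact ((1 : ℝ≥0∞) ≤ 2) := ⟨one_le_two⟩
  have : Fact ((2 : ℝ≥0∞) ≠ ⊤) := ⟨by simp⟩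
  let H := Lp ℂ 2 (volume : Measure Plane)
  let F : ℕ → H := fun n => (hf n).toLp
  have hF : ∀ n, ‖F n‖ ≤ (C ^ (1 / 2 : ℝ)).toReal := by
    intro n
    rw [Lp.norm_toLp]
    refine ENNReal.toReal_mono (ENNReal.rpow_ne_top_of_nonneg (by norm_num) hC) ?_
    rw [eLpNorm_eq_lintegral_rpow_enorm_toReal (by norm_num) (by norm_num)]
    have := hb n
    norm_num
    gcongr
  let T : ℕ → WeakDual ℂ H := fun n =>
    StrongDual.toWeakDual (InnerProductSpace.toDual ℂ H (F n))
  obtain ⟨L, -, φ, hφ, hL⟩ := WeakDual.isSeqCompact_closedBall ℂ H 0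
    (C ^ (1 / 2 : ℝ)).toReal (x := T) (fun n => by simpa [T] using hF n)
  let G : H := (InnerProductSpace.toDual ℂ H).symm (WeakDual.toStrongDual L)
  refine ⟨φ, hφ, G, Lp.memLp G, fun h hh => ?_⟩
  have hh' : MemLp (fun x => conj (h x)) 2 := hh.star
  have h1 : Tendsto (fun n => T (φ n) hh'.toLp) atTop (𝓝 (L hh'.toLp)) :=
    ((WeakDual.eval_continuous _).tendsto L).comp hL
  have h2 : ∀ (f₁ : H), inner ℂ f₁ (hh'.toLp : H) = conj (∫ x, h x * f₁ x) := by
    intro f₁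
    rw [L2.inner_def, ← integral_conj]
    refine integral_congr_ae ?_
    filter_upwards [hh'.coeFn_toLp] with x hx
    simp [hx]
  have h3 : ∀ n, T n hh'.toLp = conj (∫ x, h x * f n x) := by
    intro n
    have : T n hh'.toLp = inner ℂ (F n) (hh'.toLp : H) := rfl
    rw [this, h2]
    congr 1
    refine integral_congr_ae ?_
    filter_upwards [(hf n).coeFn_toLp] with x hx
    simp [F, hx]
  have h4 : L hh'.toLp = conj (∫ x, h x * G x) := by
    rw [← h2, ← InnerProductSpace.toDual_apply_apply]
    simp [G]
  simp_rw [h3, h4] at h1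
  simpa [Function.comp_def] using (Complex.continuous_conj.tendsto _).comp h1

lemma memLp_two_smul_of_hasCompactSupport {k : Plane → ℝ} (hk : Continuous k)
    (hs : HasCompactSupport k) : MemLp (fun x => (k x : ℂ)) 2 :=
  (Complex.continuous_ofReal.comp hk).memLp_of_hasCompactSupport
    (hs.comp_left (g := Complex.ofReal) (by simp))

lemma WeakTendsto.hasWeakPartial {i : Fin 2} {ψ g : ℕ → Plane → ℂ} {ψ' g' : Plane → ℂ}
    (h : ∀ n, HasWeakPartial i (ψ n) (g n)) (hψ : WeakTendsto ψ ψ') (hg : WeakTendsto g g')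
    (hg' : MemLp g' 2) : HasWeakPartial i ψ' g' := by
  refine ⟨hg'.locallyIntegrable (by norm_num), fun k hk hs => ?_⟩
  have hd : Continuous fun x => fderiv ℝ k x (basisVec i) :=
    (hk.continuous_fderiv (by simp)).clm_apply continuous_const
  have hds : HasCompactSupport fun x => fderiv ℝ k x (basisVec i) :=
    (hs.fderiv ℝ).comp_left (g := fun L : Plane →L[ℝ] ℝ => L (basisVec i)) (by simp)
  have h1 := hψ _ (memLp_two_smul_of_hasCompactSupport hd hds)
  have h2 := (hg _ (memLp_two_smul_of_hasCompactSupport hk.continuous hs)).neg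
  simp_rw [← Complex.real_smul] at h1 h2
  simp_rw [(h _).2 k hk hs] at h1
  exact tendsto_nhds_unique h1 h2

/-- Multiplication by the unbounded `x j` can be moved onto a compactly supported test function,
which stays in `L²`. -/
lemma WeakTendsto.ae_eq_coord_mul {j : Fin 2} {ψ : ℕ → Plane → ℂ} {ψ' k : Plane → ℂ}
    (hψ : WeakTendsto ψ ψ') (hψ' : MemLp ψ' 2)
    (hk : WeakTendsto (fun n x => (x j : ℂ) * ψ n x) k) (hk' : MemLp k 2) :
    k =ᵐ[volume] fun x => (x j : ℂ) * ψ' x := by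
  have hc : Continuous fun x : Plane => (x j : ℂ) := by fun_prop
  refine ae_eq_of_integral_contDiff_smul_eq (hk'.locallyIntegrable (by norm_num)) ?_ ?_
  · have hl : LocallyIntegrable ψ' := hψ'.locallyIntegrable (by norm_num)
    exact (locallyIntegrableOn_univ.1 ((locallyIntegrableOn_univ.2 hl).continuousOn_mul
      hc.continuousOn isOpen_univ.isLocallyClosed))
  · intro f hf hs
    have h1 := hk _ (memLp_two_smul_of_hasCompactSupport hf.continuous hs)
    have h2 := hψ (fun x => ((f x * x j : ℝ) : ℂ)) (memLp_two_smul_of_hasCompactSupport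
      (k := fun x => f x * x j) (hf.continuous.mul (by fun_prop)) hs.mul_right)
    simp_rw [Complex.real_smul]
    refine tendsto_nhds_unique h1 (h2.congr' ?_ |>.trans (le_of_eq ?_))
    · exact Eventually.of_forall fun n => by simp only [Complex.ofReal_mul, mul_assoc]
    · simp only [Complex.ofReal_mul, mul_assoc]

/-- Rellich's theorem in the weighted space: a weakly null sequence that is bounded in
`H¹ ∩ L²(|x|² dx)` converges to zero in `L²`. -/
lemma WeakTendsto.tendsto_lintegral_sq_enorm {w g₀ g₁ : ℕ → Plane → ℂ} {C : ℝ≥0∞} (hC : C ≠ ⊤)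
    (hw : ∀ n, MemLp (w n) 2) (h₀ : ∀ n, HasWeakPartial 0 (w n) (g₀ n))
    (h₁ : ∀ n, HasWeakPartial 1 (w n) (g₁ n)) (bw : ∀ n, ∫⁻ x, ‖w n x‖ₑ ^ 2 ≤ C)
    (b₀ : ∀ n, ∫⁻ x, ‖g₀ n x‖ₑ ^ 2 ≤ C) (b₁ : ∀ n, ∫⁻ x, ‖g₁ n x‖ₑ ^ 2 ≤ C)
    (bx : ∀ n, ∫⁻ x, ‖x‖ₑ ^ 2 * ‖w n x‖ₑ ^ 2 ≤ C) (hlim : WeakTendsto w 0) :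
    Tendsto (fun n => ∫⁻ x, ‖w n x‖ₑ ^ 2) atTop (𝓝 0) := by
  have hloc : ∀ n, LocallyIntegrable (w n) := fun n => (hw n).locallyIntegrable (by norm_num)
  -- the mollifications converge on every ball
  have hmoll : ∀ (ε : ℝ) (hε : 0 < ε) (R : ℝ), Tendsto (fun n =>
      ∫⁻ x in Metric.ball (0 : Plane) R, ‖mollify ε hε (w n) x‖ₑ ^ 2) atTop (𝓝 0) := by
    intro ε hε R
    set k := (bump ε hε).normed (volume : Measure Plane)
    have hkc : Continuous k := (bump ε hε).continuous_normed
    have hks : HasCompactSupport k := (bump ε hε).hasCompactSupport_normed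
    have hm : ∀ n x, mollify ε hε (w n) x = ∫ t, (k (x - t) : ℂ) * w n t := by
      intro n x
      simp_rw [← Complex.real_smul]
      exact convolution_lsmul_swap
    have hkx : ∀ x, MemLp (fun t => (k (x - t) : ℂ)) 2 := fun x =>
      memLp_two_smul_of_hasCompactSupport (k := fun t => k (x - t)) (by fun_prop)
        (hks.comp_homeomorph (Homeomorph.subLeft x))
    have hkfin : ∫⁻ t, ‖(k t : ℂ)‖ₑ ^ 2 < ⊤ :=
      (memLp_two_iff.1 (memLp_two_smul_of_hasCompactSupport hkc hks)).2
    -- Cauchy–Schwarz gives a constant majorant, integrable on the ball; pointwise convergence is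
    -- weak convergence tested against the translated kernel.
    have hbd : ∀ n x, ‖mollify ε hε (w n) x‖ₑ ^ 2 ≤ (∫⁻ t, ‖(k t : ℂ)‖ₑ ^ 2) * C := by
      intro n x
      rw [hm]
      refine (pow_le_pow_left₀ zero_le (enorm_integral_le_lintegral_enorm _) 2).trans ?_
      simp_rw [enorm_mul]
      refine (sq_lintegral_mul_le (hkx x).aestronglyMeasurable.enorm
        (hw n).aestronglyMeasurable.enorm).trans ?_
      rw [lintegral_sub_left_eq_self (fun t => ‖(k t : ℂ)‖ₑ ^ 2) x]
      gcongr
      exact bw n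
    have h := tendsto_lintegral_of_dominated_convergence
      (μ := volume.restrict (Metric.ball (0 : Plane) R)) (f := fun _ => 0)
      (F := fun n x => ‖mollify ε hε (w n) x‖ₑ ^ 2)
      (fun _ => (∫⁻ t, ‖(k t : ℂ)‖ₑ ^ 2) * C)
      (fun n => (contDiff_mollify hε (hloc n)).continuous.enorm.measurable.pow_const 2)
      (fun n => Eventually.of_forall (hbd n))
      (by rw [lintegral_const, Measure.restrict_apply_univ]
          exact ENNReal.mul_ne_top (by finiteness) measure_ball_lt_top.ne)
      (Eventually.of_forall fun x => by
        have h1 := hlim _ (hkx x)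
        simp_rw [← hm] at h1
        simpa [Function.comp_def] using ((ENNReal.continuous_pow 2).tendsto _).comp h1.enorm)
    simpa using h
  -- Inside the ball, `w n` is its mollification minus the mollification error; outside, `|x| ≥ R`
  -- bounds the mass by `R⁻²` times the second moment.
  have hsplit : ∀ (ε : ℝ) (hε : 0 < ε) (R : ℝ), 0 < R → ∀ n, ∫⁻ x, ‖w n x‖ₑ ^ 2
      ≤ 2 * (∫⁻ x in Metric.ball (0 : Plane) R, ‖mollify ε hε (w n) x‖ₑ ^ 2)
        + (2 * (ENNReal.ofReal (2 * ε) ^ 2 * (C + C)) + (ENNReal.ofReal R ^ 2)⁻¹ * C) := by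
    intro ε hε R hR n
    have hR0 : ENNReal.ofReal R ^ 2 ≠ 0 := by simp [hR]
    have hRt : ENNReal.ofReal R ^ 2 ≠ ⊤ := by finiteness
    rw [← lintegral_add_compl _ (Metric.isOpen_ball (x := (0 : Plane)) (ε := R)).measurableSet,
      ← add_assoc]
    have hmm : Measurable fun x => ‖mollify ε hε (w n) x‖ₑ ^ 2 :=
      (contDiff_mollify hε (hloc n)).continuous.enorm.measurable.pow_const 2
    gcongr
    · calc _ ≤ ∫⁻ x in Metric.ball (0 : Plane) R, (2 * ‖mollify ε hε (w n) x‖ₑ ^ 2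
            + 2 * ‖mollify ε hε (w n) x - w n x‖ₑ ^ 2) := by
            refine lintegral_mono fun x => le_trans ?_ (ennreal_add_sq_le _ _)
            gcongr
            have : w n x = mollify ε hε (w n) x - (mollify ε hε (w n) x - w n x) := by ring
            conv_lhs => rw [this]
            exact enorm_sub_le
        _ ≤ _ := by
            rw [lintegral_add_left (by fun_prop), lintegral_const_mul' _ _ (by simp),
              lintegral_const_mul' _ _ (by simp)]
            gcongr
            refine (setLIntegral_le_lintegral _ _).trans
              ((lintegral_sq_enorm_mollify_sub_le hε (hloc n) (h₀ n) (h₁ n)).trans ?_)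
            gcongr
            exacts [b₀ n, b₁ n]
    · calc _ ≤ ∫⁻ x in (Metric.ball (0 : Plane) R)ᶜ,
            (ENNReal.ofReal R ^ 2)⁻¹ * (‖x‖ₑ ^ 2 * ‖w n x‖ₑ ^ 2) := by
            refine setLIntegral_mono_ae' Metric.isOpen_ball.measurableSet.compl
              (Eventually.of_forall fun x hx => ?_)
            have hx' : ENNReal.ofReal R ≤ ‖x‖ₑ := by
              rw [← ofReal_norm]
              exact ENNReal.ofReal_le_ofReal (by simpa using hx)
            rw [← mul_assoc]
            refine le_mul_of_one_le_left zero_le ?_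
            rw [← ENNReal.inv_mul_cancel hR0 hRt]
            gcongr
        _ ≤ _ := by
            rw [lintegral_const_mul' _ _ (by finiteness)]
            gcongr
            exact (setLIntegral_le_lintegral _ _).trans (bx n)
  refine ENNReal.tendsto_nhds_zero.2 fun δ hδ => ?_
  have hs1 : Tendsto (fun ε : ℝ => 2 * (ENNReal.ofReal (2 * ε) ^ 2 * (C + C)))
      (𝓝[>] 0) (𝓝 0) := by
    have h : Tendsto (fun ε : ℝ => ENNReal.ofReal (2 * ε) ^ 2) (𝓝[>] 0) (𝓝 0) := by
      have : Continuous fun ε : ℝ => ENNReal.ofReal (2 * ε) ^ 2 :=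
        (ENNReal.continuous_pow 2).comp (ENNReal.continuous_ofReal.comp (by fun_prop))
      simpa using (this.tendsto 0).mono_left nhdsWithin_le_nhds
    have h' := ENNReal.Tendsto.const_mul (a := 2)
      (ENNReal.Tendsto.mul_const (b := C + C) h (Or.inr (by finiteness))) (Or.inr (by simp))
    simpa using h'
  have hs2 : Tendsto (fun R : ℝ => (ENNReal.ofReal R ^ 2)⁻¹ * C) atTop (𝓝 0) := by
    have h : Tendsto (fun R : ℝ => (ENNReal.ofReal R ^ 2)⁻¹) atTop (𝓝 0) := by
      have h1 : Tendsto (fun R : ℝ => ENNReal.ofReal R ^ 2) atTop (𝓝 ⊤) := by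
        simpa [Function.comp_def] using ((ENNReal.continuous_pow 2).tendsto ⊤).comp ENNReal.tendsto_ofReal_atTop
      simpa using tendsto_inv_iff.2 h1
    simpa using ENNReal.Tendsto.mul_const (b := C) h (Or.inr hC)
  -- The last two terms are bounded uniformly in `n`, so `ε` and `R` are fixed before `n`; each of
  -- the three terms gets `δ / 3`.
  have hδ3 : 0 < δ / 3 := ENNReal.div_pos hδ.ne' (by simp)
  obtain ⟨ε, hε2, hε⟩ := ((hs1.eventually (ge_mem_nhds hδ3)).and self_mem_nhdsWithin).exists
  obtain ⟨R, hR2, hR⟩ := ((hs2.eventually (ge_mem_nhds hδ3)).and (eventually_gt_atTop 0)).exists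
  have hs3 : Tendsto (fun n => 2 * ∫⁻ x in Metric.ball (0 : Plane) R,
      ‖mollify ε hε (w n) x‖ₑ ^ 2) atTop (𝓝 0) := by
    simpa using ENNReal.Tendsto.const_mul (a := 2) (hmoll ε hε R) (Or.inr (by simp))
  filter_upwards [hs3.eventually (ge_mem_nhds hδ3)] with n hn
  refine (hsplit ε hε R hR n).trans ?_
  calc _ ≤ δ / 3 + (δ / 3 + δ / 3) := add_le_add hn (add_le_add hε2 hR2)
    _ = δ := by rw [← add_assoc]; exact ENNReal.add_thirds δ

/-! ### Norms as integrals, and lower bounds for weak limits -/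

lemma integral_add_add_add {a b c d : Plane → ℝ} (ha : Integrable a) (hb : Integrable b)
    (hc : Integrable c) (hd : Integrable d) :
    ∫ x, (a x + b x + c x + d x) = (∫ x, a x) + (∫ x, b x) + (∫ x, c x) + ∫ x, d x := by
  have hab : Integrable fun x => a x + b x := ha.add hb
  have habc : Integrable fun x => a x + b x + c x := hab.add hc
  rw [integral_add habc hd, integral_add hab hc, integral_add ha hb]

section Norms

variable {f g : Plane → ℂ}

lemma integrable_sq_norm (hf : MemLp f 2) : Integrable fun x => ‖f x‖ ^ 2 :=
  (memLp_two_iff_integrable_sq_norm hf.1).1 hf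

lemma lpNorm_two_sq (hf : MemLp f 2) : lpNorm f 2 volume ^ 2 = ∫ x, ‖f x‖ ^ 2 := by
  rw [lpNorm_eq_integral_norm_rpow_toReal (by norm_num) (by norm_num) hf.1, ← Real.rpow_natCast,
    ← Real.rpow_mul (integral_nonneg fun x => by positivity)]
  norm_num

lemma lpNorm_four_pow (hf : MemLp f 4) : lpNorm f 4 volume ^ 4 = ∫ x, ‖f x‖ ^ 4 := by
  rw [lpNorm_eq_integral_norm_rpow_toReal (by norm_num) (by norm_num) hf.1, ← Real.rpow_natCast,
    ← Real.rpow_mul (integral_nonneg fun x => by positivity)]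
  norm_num

lemma lintegral_sq_enorm_eq (hf : MemLp f 2) :
    ∫⁻ x, ‖f x‖ₑ ^ 2 = ENNReal.ofReal (∫ x, ‖f x‖ ^ 2) := by
  rw [ofReal_integral_eq_lintegral_ofReal (integrable_sq_norm hf)
    (Eventually.of_forall fun x => by positivity)]
  simp_rw [ENNReal.ofReal_pow (norm_nonneg _), ofReal_norm]

lemma lintegral_pow_four_enorm_eq (hf : MemLp f 4) :
    ∫⁻ x, ‖f x‖ₑ ^ 4 = ENNReal.ofReal (lpNorm f 4 volume ^ 4) := by
  have hi : Integrable fun x => ‖f x‖ ^ 4 := by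
    simpa using hf.integrable_norm_rpow (by norm_num) (by norm_num)
  rw [lpNorm_four_pow hf, ofReal_integral_eq_lintegral_ofReal hi
    (Eventually.of_forall fun x => by positivity)]
  simp_rw [ENNReal.ofReal_pow (norm_nonneg _), ofReal_norm]

/-- Expand `‖f - g‖² ≥ 0`. The minorant is affine in `f`, hence weakly continuous, and is exact at
`f = g`: this is the source of lower semicontinuity. -/
lemma integral_sq_norm_ge (hf : MemLp f 2) (hg : MemLp g 2) :
    2 * (∫ x, conj (g x) * f x).re - ∫ x, ‖g x‖ ^ 2 ≤ ∫ x, ‖f x‖ ^ 2 := by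
  have hi : Integrable fun x => conj (g x) * f x := integrable_mul_of_memLp hg.star hf
  have hir : Integrable fun x => (conj (g x) * f x).re := hi.re
  have hre : (∫ x, conj (g x) * f x).re = ∫ x, (conj (g x) * f x).re :=
    (integral_re hi).symm
  rw [hre, ← integral_const_mul, ← integral_sub (hir.const_mul 2) (integrable_sq_norm hg)]
  refine integral_mono ((hir.const_mul 2).sub (integrable_sq_norm hg))
    (integrable_sq_norm hf) fun x => ?_
  simp only [← Complex.normSq_eq_norm_sq, Complex.normSq_apply, Complex.mul_re, Complex.conj_re,
    Complex.conj_im]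
  nlinarith [sq_nonneg ((f x).re - (g x).re), sq_nonneg ((f x).im - (g x).im)]

lemma integral_conj_mul_self_re (g : Plane → ℂ) :
    (∫ x, conj (g x) * g x).re = ∫ x, ‖g x‖ ^ 2 := by
  have : ∀ x, conj (g x) * g x = ((‖g x‖ ^ 2 : ℝ) : ℂ) := fun x => by
    rw [Complex.conj_mul']; simp
  rw [integral_congr_ae (Eventually.of_forall this), integral_complex_ofReal]
  exact Complex.ofReal_re _

lemma WeakTendsto.lower_bound_tendsto {f : ℕ → Plane → ℂ} (h : WeakTendsto f g) (hg : MemLp g 2) :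
    Tendsto (fun n => 2 * (∫ x, conj (g x) * f n x).re - ∫ x, ‖g x‖ ^ 2) atTop
      (𝓝 (∫ x, ‖g x‖ ^ 2)) := by
  have h1 := ((Complex.continuous_re.tendsto _).comp (h _ hg.star)).const_mul 2
  have h2 := h1.sub_const (∫ x, ‖g x‖ ^ 2)
  have h3 : (∫ x, (star g) x * g x).re = ∫ x, ‖g x‖ ^ 2 := integral_conj_mul_self_re g
  rw [h3] at h2
  refine h2.congr' (Eventually.of_forall fun n => rfl) |>.trans (le_of_eq ?_)
  congr 1
  ring

end Norms

/-! ### Calculus of weak derivatives -/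

section WeakDerivatives

variable {i : Fin 2} {ψ ψ' g g' : Plane → ℂ}

lemma HasWeakPartial.ae_eq (h : HasWeakPartial i ψ g) (h' : HasWeakPartial i ψ g') :
    g =ᵐ[volume] g' :=
  ae_eq_of_integral_contDiff_smul_eq h.1 h'.1 fun k hk hs =>
    neg_injective ((h.2 k hk hs).symm.trans (h'.2 k hk hs))

lemma hasWeakPartial_weakPartial (h : ∃ g, HasWeakPartial i ψ g) :
    HasWeakPartial i ψ (weakPartial i ψ) := by
  rw [weakPartial, dif_pos h]; exact h.choose_spec

lemma HasWeakPartial.weakPartial_ae_eq (h : HasWeakPartial i ψ g) :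
    weakPartial i ψ =ᵐ[volume] g :=
  (hasWeakPartial_weakPartial ⟨g, h⟩).ae_eq h

lemma HasWeakPartial.const_mul (h : HasWeakPartial i ψ g) (c : ℂ) :
    HasWeakPartial i (fun x => c * ψ x) (fun x => c * g x) := by
  refine ⟨h.1.smul c, fun k hk hs => ?_⟩
  simp_rw [← mul_smul_comm, integral_const_mul, h.2 k hk hs, mul_neg]

lemma HasWeakPartial.add (hψ : LocallyIntegrable ψ) (hψ' : LocallyIntegrable ψ')
    (h : HasWeakPartial i ψ g) (h' : HasWeakPartial i ψ' g') :
    HasWeakPartial i (fun x => ψ x + ψ' x) (fun x => g x + g' x) := by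
  refine ⟨h.1.add h'.1, fun k hk hs => ?_⟩
  have hd : Continuous fun x => fderiv ℝ k x (basisVec i) :=
    (hk.continuous_fderiv (by simp)).clm_apply continuous_const
  have hds : HasCompactSupport fun x => fderiv ℝ k x (basisVec i) :=
    (hs.fderiv ℝ).comp_left (g := fun L : Plane →L[ℝ] ℝ => L (basisVec i)) (by simp)
  simp_rw [smul_add]
  rw [integral_add (hψ.integrable_smul_left_of_hasCompactSupport hd hds)
      (hψ'.integrable_smul_left_of_hasCompactSupport hd hds),
    integral_add (h.1.integrable_smul_left_of_hasCompactSupport hk.continuous hs)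
      (h'.1.integrable_smul_left_of_hasCompactSupport hk.continuous hs), h.2 k hk hs, h'.2 k hk hs,
    neg_add]

lemma HasWeakPartial.sub (hψ : LocallyIntegrable ψ) (hψ' : LocallyIntegrable ψ')
    (h : HasWeakPartial i ψ g) (h' : HasWeakPartial i ψ' g') :
    HasWeakPartial i (fun x => ψ x - ψ' x) (fun x => g x - g' x) := by
  have := h.add hψ (hψ'.smul (-1 : ℂ)) (h'.const_mul (-1))
  simpa [sub_eq_add_neg] using this

lemma hasWeakPartial_of_contDiff (hψ : ContDiff ℝ 1 ψ) :
    HasWeakPartial i ψ (fun x => fderiv ℝ ψ x (basisVec i)) := by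
  have hc : Continuous fun x => fderiv ℝ ψ x (basisVec i) :=
    (hψ.continuous_fderiv one_ne_zero).clm_apply continuous_const
  refine ⟨hc.locallyIntegrable, fun k hk hs => ?_⟩
  have hd : Continuous fun x => fderiv ℝ k x (basisVec i) :=
    (hk.continuous_fderiv (by simp)).clm_apply continuous_const
  have hds : HasCompactSupport fun x => fderiv ℝ k x (basisVec i) :=
    (hs.fderiv ℝ).comp_left (g := fun L : Plane →L[ℝ] ℝ => L (basisVec i)) (by simp)
  rw [integral_smul_fderiv_eq_neg_fderiv_smul_of_integrable (f := k) (g := ψ)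
    (hψ.continuous.locallyIntegrable.integrable_smul_left_of_hasCompactSupport hd hds)
    (hc.locallyIntegrable.integrable_smul_left_of_hasCompactSupport hk.continuous hs)
    (hψ.continuous.locallyIntegrable.integrable_smul_left_of_hasCompactSupport hk.continuous hs)
    (fun x _ => hk.differentiable (by simp) x) (fun x _ => hψ.differentiable one_ne_zero x), neg_neg]

end WeakDerivatives

/-! ### The energy and its form domain -/

section Energy

variable {Ω : ℝ} {ψ : Plane → ℂ}

/-- The covariant derivative `∂₁ - i Ω x₂`. -/
noncomputable def covDeriv₀ (Ω : ℝ) (ψ : Plane → ℂ) (x : Plane) : ℂ :=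
  weakPartial 0 ψ x + (-Complex.I * Ω) * ((x 1 : ℂ) * ψ x)

/-- The covariant derivative `∂₂ + i Ω x₁`. -/
noncomputable def covDeriv₁ (Ω : ℝ) (ψ : Plane → ℂ) (x : Plane) : ℂ :=
  weakPartial 1 ψ x + (Complex.I * Ω) * ((x 0 : ℂ) * ψ x)

/-- Completing the square absorbs the rotation term at the cost of `½Ω²|x|²|ψ|²`. All coefficients
stay nonnegative when `Ω² ≤ 1`, and every squared quantity is linear in `ψ`. -/
lemma energyDensity_eq (Ω : ℝ) (ψ : Plane → ℂ) (x : Plane) :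
    energyDensity Ω ψ x = (1 / 2) * ‖covDeriv₀ Ω ψ x‖ ^ 2 + (1 / 2) * ‖covDeriv₁ Ω ψ x‖ ^ 2
      + (1 - Ω ^ 2) / 2 * ‖(x 0 : ℂ) * ψ x‖ ^ 2 + (1 - Ω ^ 2) / 2 * ‖(x 1 : ℂ) * ψ x‖ ^ 2 := by
  simp only [energyDensity, covDeriv₀, covDeriv₁, angularMomentum, EuclideanSpace.norm_sq_eq,
    Fin.sum_univ_two, Real.norm_eq_abs, sq_abs, ← Complex.normSq_eq_norm_sq, Complex.normSq_apply,
    Complex.mul_re, Complex.mul_im, Complex.add_re, Complex.add_im, Complex.sub_re, Complex.sub_im,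
    Complex.ofReal_re, Complex.ofReal_im, Complex.I_re, Complex.I_im, Complex.conj_re,
    Complex.conj_im, Complex.neg_re, Complex.neg_im]
  ring

/-- In either inequality the two sides differ by `Ω / 2` times a sum of four real squares, pairing
each partial derivative with the other coordinate times `ψ`. -/
lemma energyDensity_bounds (hΩ : 0 ≤ Ω) (ψ : Plane → ℂ) (x : Plane) :
    (1 - Ω) / 2 * (‖weakPartial 0 ψ x‖ ^ 2 + ‖weakPartial 1 ψ x‖ ^ 2 + ‖(x 0 : ℂ) * ψ x‖ ^ 2
        + ‖(x 1 : ℂ) * ψ x‖ ^ 2) ≤ energyDensity Ω ψ x ∧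
      energyDensity Ω ψ x ≤ (1 + Ω) / 2 * (‖weakPartial 0 ψ x‖ ^ 2 + ‖weakPartial 1 ψ x‖ ^ 2
        + ‖(x 0 : ℂ) * ψ x‖ ^ 2 + ‖(x 1 : ℂ) * ψ x‖ ^ 2) := by
  simp only [energyDensity, angularMomentum, EuclideanSpace.norm_sq_eq,
    Fin.sum_univ_two, Real.norm_eq_abs, sq_abs, ← Complex.normSq_eq_norm_sq, Complex.normSq_apply,
    Complex.mul_re, Complex.mul_im, Complex.sub_re, Complex.sub_im,
    Complex.ofReal_re, Complex.ofReal_im, Complex.I_re, Complex.I_im, Complex.conj_re,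
    Complex.conj_im]
  generalize (weakPartial 0 ψ x).re = a
  generalize (weakPartial 0 ψ x).im = b
  generalize (weakPartial 1 ψ x).re = c
  generalize (weakPartial 1 ψ x).im = d
  generalize (ψ x).re = p
  generalize (ψ x).im = q
  generalize x 0 = u
  generalize x 1 = v
  constructor
  · have h1 := mul_nonneg hΩ (add_nonneg (add_nonneg (sq_nonneg (c - u * q)) (sq_nonneg (d + u * p)))
      (add_nonneg (sq_nonneg (a + v * q)) (sq_nonneg (b - v * p))))
    have h2 := mul_nonneg hΩ (add_nonneg (add_nonneg (sq_nonneg (c + u * q)) (sq_nonneg (d - u * p)))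
      (add_nonneg (sq_nonneg (a - v * q)) (sq_nonneg (b + v * p))))
    linarith
  · have h1 := mul_nonneg hΩ (add_nonneg (add_nonneg (sq_nonneg (c - u * q)) (sq_nonneg (d + u * p)))
      (add_nonneg (sq_nonneg (a + v * q)) (sq_nonneg (b - v * p))))
    have h2 := mul_nonneg hΩ (add_nonneg (add_nonneg (sq_nonneg (c + u * q)) (sq_nonneg (d - u * p)))
      (add_nonneg (sq_nonneg (a - v * q)) (sq_nonneg (b + v * p))))
    linarith

lemma energyDensity_nonneg (hΩ : Ω ∈ Ico (0 : ℝ) 1) (ψ : Plane → ℂ) (x : Plane) :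
    0 ≤ energyDensity Ω ψ x :=
  le_trans (by have := hΩ.2; have : 0 ≤ (1 - Ω) / 2 := by linarith
               positivity) (energyDensity_bounds hΩ.1 ψ x).1

/-- The square-integrable functions whose weak gradient and first moments are square-integrable. -/
structure InWeightedH1 (ψ : Plane → ℂ) : Prop where
  memLp : MemLp ψ 2
  hasWeakPartial : ∀ i, HasWeakPartial i ψ (weakPartial i ψ)
  memLp_partial : ∀ i, MemLp (weakPartial i ψ) 2
  memLp_coord : ∀ i : Fin 2, MemLp (fun x : Plane => (x i : ℂ) * ψ x) 2

/-- `weakPartial` is a choice, determined only almost everywhere; this constructor accepts any weak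
derivatives. -/
lemma InWeightedH1.mk' {g : Fin 2 → Plane → ℂ} (h : MemLp ψ 2) (hg : ∀ i, HasWeakPartial i ψ (g i))
    (hg2 : ∀ i, MemLp (g i) 2) (hx : ∀ i : Fin 2, MemLp (fun x : Plane => (x i : ℂ) * ψ x) 2) :
    InWeightedH1 ψ :=
  ⟨h, fun i => hasWeakPartial_weakPartial ⟨_, hg i⟩,
    fun i => (memLp_congr_ae (hg i).weakPartial_ae_eq).2 (hg2 i), hx⟩

lemma InWeightedH1.memLp_covDeriv₀ (h : InWeightedH1 ψ) (Ω : ℝ) : MemLp (covDeriv₀ Ω ψ) 2 :=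
  (h.memLp_partial 0).add ((h.memLp_coord 1).const_mul _)

lemma InWeightedH1.memLp_covDeriv₁ (h : InWeightedH1 ψ) (Ω : ℝ) : MemLp (covDeriv₁ Ω ψ) 2 :=
  (h.memLp_partial 1).add ((h.memLp_coord 0).const_mul _)

lemma InWeightedH1.integrable_energyDensity (h : InWeightedH1 ψ) (Ω : ℝ) :
    Integrable (energyDensity Ω ψ) := by
  have : energyDensity Ω ψ = fun x => (1 / 2) * ‖covDeriv₀ Ω ψ x‖ ^ 2
      + (1 / 2) * ‖covDeriv₁ Ω ψ x‖ ^ 2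
      + (1 - Ω ^ 2) / 2 * ‖(x 0 : ℂ) * ψ x‖ ^ 2 + (1 - Ω ^ 2) / 2 * ‖(x 1 : ℂ) * ψ x‖ ^ 2 :=
    funext (energyDensity_eq Ω ψ)
  rw [this]
  exact ((((integrable_sq_norm (h.memLp_covDeriv₀ Ω)).const_mul _).add
    ((integrable_sq_norm (h.memLp_covDeriv₁ Ω)).const_mul _)).add
    ((integrable_sq_norm (h.memLp_coord 0)).const_mul _)).add
    ((integrable_sq_norm (h.memLp_coord 1)).const_mul _)

lemma InWeightedH1.integral_energyDensity (h : InWeightedH1 ψ) (Ω : ℝ) :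
    ∫ x, energyDensity Ω ψ x = (1 / 2) * (∫ x, ‖covDeriv₀ Ω ψ x‖ ^ 2)
      + (1 / 2) * (∫ x, ‖covDeriv₁ Ω ψ x‖ ^ 2)
      + (1 - Ω ^ 2) / 2 * (∫ x : Plane, ‖(x 0 : ℂ) * ψ x‖ ^ 2)
      + (1 - Ω ^ 2) / 2 * ∫ x : Plane, ‖(x 1 : ℂ) * ψ x‖ ^ 2 := by
  simp_rw [energyDensity_eq]
  have i0 := (integrable_sq_norm (h.memLp_covDeriv₀ Ω)).const_mul (1 / 2)
  have i1 := (integrable_sq_norm (h.memLp_covDeriv₁ Ω)).const_mul (1 / 2)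
  have i2 := (integrable_sq_norm (h.memLp_coord 0)).const_mul ((1 - Ω ^ 2) / 2)
  have i3 := (integrable_sq_norm (h.memLp_coord 1)).const_mul ((1 - Ω ^ 2) / 2)
  rw [integral_add_add_add i0 i1 i2 i3]
  simp_rw [integral_const_mul]

/-- Forward, the coercive lower bound, whose constant is positive as `Ω < 1`, dominates each
component; backward, the density is a combination of integrable squares. -/
lemma mem_formDomain_iff (hΩ : Ω ∈ Ico (0 : ℝ) 1) : ψ ∈ formDomain Ω ↔ InWeightedH1 ψ := by
  constructor
  · rintro ⟨h2, hw, hi⟩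
    have hc : 0 < (1 - Ω) / 2 := by linarith [hΩ.2]
    have hp : ∀ i, HasWeakPartial i ψ (weakPartial i ψ) := fun i => hasWeakPartial_weakPartial (hw i)
    have hdom : ∀ f : Plane → ℂ, AEStronglyMeasurable f → (∀ x, (1 - Ω) / 2 * ‖f x‖ ^ 2 ≤
        energyDensity Ω ψ x) → MemLp f 2 := by
      intro f hf hle
      refine (memLp_two_iff_integrable_sq_norm hf).2
        ((hi.const_mul ((1 - Ω) / 2)⁻¹).mono' (hf.norm.pow 2) (Eventually.of_forall fun x => ?_))
      rw [Real.norm_of_nonneg (by positivity), le_inv_mul_iff₀ hc]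
      exact hle x
    have hb := fun x => (energyDensity_bounds hΩ.1 ψ x).1
    have hle : ∀ a b : ℝ, a ≤ b → (1 - Ω) / 2 * a ≤ (1 - Ω) / 2 * b := fun a b hab =>
      mul_le_mul_of_nonneg_left hab hc.le
    have hm : ∀ i : Fin 2, AEStronglyMeasurable (fun x : Plane => (x i : ℂ) * ψ x) := fun i =>
      (Continuous.aestronglyMeasurable (by fun_prop)).mul h2.1
    refine ⟨h2, hp, fun i => hdom _ (hp i).1.aestronglyMeasurable fun x => (hle _ _ ?_).trans (hb x),
      fun i => hdom _ (hm i) fun x => (hle _ _ ?_).trans (hb x)⟩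
    · fin_cases i <;> simp only [Fin.zero_eta, Fin.mk_one] <;>
        nlinarith [sq_nonneg ‖weakPartial 0 ψ x‖, sq_nonneg ‖weakPartial 1 ψ x‖,
          sq_nonneg ‖(x 0 : ℂ) * ψ x‖, sq_nonneg ‖(x 1 : ℂ) * ψ x‖]
    · fin_cases i <;> simp only [Fin.zero_eta, Fin.mk_one] <;>
        nlinarith [sq_nonneg ‖weakPartial 0 ψ x‖, sq_nonneg ‖weakPartial 1 ψ x‖,
          sq_nonneg ‖(x 0 : ℂ) * ψ x‖, sq_nonneg ‖(x 1 : ℂ) * ψ x‖]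
  · intro h
    exact ⟨h.memLp, fun i => ⟨_, h.hasWeakPartial i⟩, h.integrable_energyDensity Ω⟩

lemma InWeightedH1.integral_bound (hΩ : Ω ∈ Ico (0 : ℝ) 1) (h : InWeightedH1 ψ) :
    (1 - Ω) / 2 * ((∫ x, ‖weakPartial 0 ψ x‖ ^ 2) + (∫ x, ‖weakPartial 1 ψ x‖ ^ 2)
      + (∫ x : Plane, ‖(x 0 : ℂ) * ψ x‖ ^ 2) + ∫ x : Plane, ‖(x 1 : ℂ) * ψ x‖ ^ 2)
      ≤ ∫ x, energyDensity Ω ψ x := by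
  have i0 := integrable_sq_norm (h.memLp_partial 0)
  have i1 := integrable_sq_norm (h.memLp_partial 1)
  have i2 := integrable_sq_norm (h.memLp_coord 0)
  have i3 := integrable_sq_norm (h.memLp_coord 1)
  rw [← integral_add_add_add i0 i1 i2 i3, ← integral_const_mul]
  exact integral_mono ((((i0.add i1).add i2).add i3).const_mul _) (h.integrable_energyDensity Ω)
    fun x => (energyDensity_bounds hΩ.1 ψ x).1

lemma InWeightedH1.const_mul (h : InWeightedH1 ψ) (c : ℂ) : InWeightedH1 fun x => c * ψ x :=
  .mk' (h.memLp.const_mul c) (fun i => (h.hasWeakPartial i).const_mul c)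
    (fun i => (h.memLp_partial i).const_mul c) fun i => by
      simpa only [mul_left_comm] using (h.memLp_coord i).const_mul c

lemma InWeightedH1.integral_energyDensity_const_mul (h : InWeightedH1 ψ) (Ω t : ℝ) :
    ∫ x, energyDensity Ω (fun x => (t : ℂ) * ψ x) x = t ^ 2 * ∫ x, energyDensity Ω ψ x := by
  rw [← integral_const_mul]
  refine integral_congr_ae ?_
  filter_upwards [((h.hasWeakPartial 0).const_mul t).weakPartial_ae_eq,
    ((h.hasWeakPartial 1).const_mul t).weakPartial_ae_eq] with x h0 h1
  have e0 : covDeriv₀ Ω (fun x => (t : ℂ) * ψ x) x = t * covDeriv₀ Ω ψ x := by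
    simp only [covDeriv₀, h0]; ring
  have e1 : covDeriv₁ Ω (fun x => (t : ℂ) * ψ x) x = t * covDeriv₁ Ω ψ x := by
    simp only [covDeriv₁, h1]; ring
  simp only [energyDensity_eq, e0, e1, norm_mul, mul_pow, Complex.norm_real, Real.norm_eq_abs,
    sq_abs]
  ring

lemma InWeightedH1.of_contDiff (h : ContDiff ℝ 1 ψ) (hs : HasCompactSupport ψ) :
    InWeightedH1 ψ :=
  .mk' (h.continuous.memLp_of_hasCompactSupport hs) (fun i => hasWeakPartial_of_contDiff h)
    (fun i => ((h.continuous_fderiv one_ne_zero).clm_apply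
      continuous_const).memLp_of_hasCompactSupport
      ((hs.fderiv ℝ).comp_left (g := fun L : Plane →L[ℝ] ℂ => L (basisVec i)) (by simp)))
    fun i => Continuous.memLp_of_hasCompactSupport (by have := h.continuous; fun_prop)
      hs.mul_left

lemma InWeightedH1.memLp_four (h : InWeightedH1 ψ) : MemLp ψ 4 :=
  memLp_four_of_hasWeakPartial h.memLp (h.hasWeakPartial 0) (h.hasWeakPartial 1)
    (h.memLp_partial 0) (h.memLp_partial 1)

end Energy

/-! ### Compactness and lower semicontinuity for the energy -/

lemma enorm_sq_mul_enorm_sq_eq (x : Plane) (z : ℂ) :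
    ‖x‖ₑ ^ 2 * ‖z‖ₑ ^ 2 = ‖(x 0 : ℂ) * z‖ₑ ^ 2 + ‖(x 1 : ℂ) * z‖ₑ ^ 2 := by
  simp only [← ofReal_norm, ← ENNReal.ofReal_pow (norm_nonneg _)]
  rw [← ENNReal.ofReal_mul (by positivity), ← ENNReal.ofReal_add (by positivity) (by positivity)]
  simp only [EuclideanSpace.norm_sq_eq, Fin.sum_univ_two, norm_mul, Complex.norm_real, mul_pow,
    add_mul]

lemma lintegral_sq_enorm_sub_le {f g : Plane → ℂ} (hf : AEStronglyMeasurable f) {C D : ℝ≥0∞}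
    (hC : ∫⁻ x, ‖f x‖ₑ ^ 2 ≤ C) (hD : ∫⁻ x, ‖g x‖ₑ ^ 2 ≤ D) :
    ∫⁻ x, ‖f x - g x‖ₑ ^ 2 ≤ 2 * C + 2 * D := by
  calc _ ≤ ∫⁻ x, (2 * ‖f x‖ₑ ^ 2 + 2 * ‖g x‖ₑ ^ 2) := by
        refine lintegral_mono fun x => le_trans ?_ (ennreal_add_sq_le _ _)
        gcongr
        exact enorm_sub_le
    _ ≤ _ := by
        rw [lintegral_add_left' ((hf.enorm.pow_const 2).const_mul 2),
          lintegral_const_mul' _ _ (by simp), lintegral_const_mul' _ _ (by simp)]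
        gcongr

/-- A weakly convergent sequence in the weighted Sobolev space that is bounded there converges
strongly in `L²`. -/
lemma tendsto_eLpNorm_sub_of_weakTendsto {ψ : ℕ → Plane → ℂ} {ψ' : Plane → ℂ}
    (h : ∀ n, InWeightedH1 (ψ n)) (h' : InWeightedH1 ψ') {C : ℝ≥0∞} (hC : C ≠ ⊤)
    (b : ∀ n, ∫⁻ x, ‖ψ n x‖ₑ ^ 2 ≤ C)
    (bp : ∀ i n, ∫⁻ x, ‖weakPartial i (ψ n) x‖ₑ ^ 2 ≤ C)
    (bx : ∀ (i : Fin 2) n, ∫⁻ x : Plane, ‖(x i : ℂ) * ψ n x‖ₑ ^ 2 ≤ C)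
    (hw : WeakTendsto ψ ψ') :
    Tendsto (fun n => eLpNorm (ψ n - ψ') 2 volume) atTop (𝓝 0) := by
  have hl : ∀ {f : Plane → ℂ}, MemLp f 2 → LocallyIntegrable f :=
    fun hf => hf.locallyIntegrable (by norm_num)
  let D : ℝ≥0∞ := (∫⁻ x, ‖ψ' x‖ₑ ^ 2) + ((∫⁻ x, ‖weakPartial 0 ψ' x‖ₑ ^ 2)
    + (∫⁻ x, ‖weakPartial 1 ψ' x‖ₑ ^ 2)) + ((∫⁻ x : Plane, ‖(x 0 : ℂ) * ψ' x‖ₑ ^ 2)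
    + ∫⁻ x : Plane, ‖(x 1 : ℂ) * ψ' x‖ₑ ^ 2)
  have hD : D < ⊤ := by
    have a0 := (memLp_two_iff.1 h'.memLp).2
    have a1 := (memLp_two_iff.1 (h'.memLp_partial 0)).2
    have a2 := (memLp_two_iff.1 (h'.memLp_partial 1)).2
    have a3 := (memLp_two_iff.1 (h'.memLp_coord 0)).2
    have a4 := (memLp_two_iff.1 (h'.memLp_coord 1)).2
    simp only [D, ENNReal.add_lt_top]
    exact ⟨⟨a0, a1, a2⟩, a3, a4⟩
  -- Each component of the difference costs `2C + 2D`; the weight `|x|²` splits into two coordinate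
  -- terms, hence the doubling.
  let B : ℝ≥0∞ := (2 * C + 2 * D) + (2 * C + 2 * D)
  have hB : 2 * C + 2 * D ≠ ⊤ :=
    ENNReal.add_ne_top.2 ⟨ENNReal.mul_ne_top (by simp) hC, ENNReal.mul_ne_top (by simp) hD.ne⟩
  have hsub0 : WeakTendsto (fun n x => ψ n x - ψ' x) 0 := by
    have hc : WeakTendsto (fun _ x => -1 * ψ' x) (fun x => -1 * ψ' x) := fun k _ =>
      tendsto_const_nhds
    have := hw.add hc (fun n => (h n).memLp) (fun _ => h'.memLp.const_mul _) h'.memLp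
      (h'.memLp.const_mul _)
    simp only [neg_mul, one_mul, add_neg_cancel, ← sub_eq_add_neg] at this
    exact this
  have key := WeakTendsto.tendsto_lintegral_sq_enorm (C := B)
    (w := fun n x => ψ n x - ψ' x) (g₀ := fun n x => weakPartial 0 (ψ n) x - weakPartial 0 ψ' x)
    (g₁ := fun n x => weakPartial 1 (ψ n) x - weakPartial 1 ψ' x) (ENNReal.add_ne_top.2 ⟨hB, hB⟩)
    (fun n => (h n).memLp.sub h'.memLp)
    (fun n => ((h n).hasWeakPartial 0).sub (hl (h n).memLp) (hl h'.memLp) (h'.hasWeakPartial 0))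
    (fun n => ((h n).hasWeakPartial 1).sub (hl (h n).memLp) (hl h'.memLp) (h'.hasWeakPartial 1))
    (fun n => (lintegral_sq_enorm_sub_le (h n).memLp.1 (b n) (D := D)
      (le_add_right le_self_add)).trans le_self_add)
    (fun n => (lintegral_sq_enorm_sub_le ((h n).memLp_partial 0).1 (bp 0 n) (D := D)
      (le_add_right (le_add_left le_self_add))).trans le_self_add)
    (fun n => (lintegral_sq_enorm_sub_le ((h n).memLp_partial 1).1 (bp 1 n) (D := D)
      (le_add_right (le_add_left le_add_self))).trans le_self_add)
    (fun n => by
      have m0 : AEMeasurable (fun x : Plane => ‖(x 0 : ℂ) * (ψ n x - ψ' x)‖ₑ ^ 2) := by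
        have := ((h n).memLp_coord 0).sub (h'.memLp_coord 0)
        have h2 := this.1.enorm.pow_const 2
        simpa only [Pi.sub_apply, ← mul_sub] using h2
      simp_rw [enorm_sq_mul_enorm_sq_eq]
      rw [lintegral_add_left' m0]
      simp_rw [mul_sub]
      exact add_le_add
        (lintegral_sq_enorm_sub_le ((h n).memLp_coord 0).1 (bx 0 n) (D := D)
          (le_add_left le_self_add))
        (lintegral_sq_enorm_sub_le ((h n).memLp_coord 1).1 (bx 1 n) (D := D)
          (le_add_left le_add_self)))
    hsub0
  have hr := ((ENNReal.continuous_rpow_const (y := 1 / 2)).tendsto _).comp key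
  rw [ENNReal.zero_rpow_of_pos (by norm_num)] at hr
  refine hr.congr fun n => ?_
  rw [eLpNorm_eq_lintegral_rpow_enorm_toReal (by norm_num) (by norm_num)]
  simp

lemma InWeightedH1.lintegral_bounds {Ω : ℝ} (hΩ : Ω ∈ Ico (0 : ℝ) 1) {ψ : Plane → ℂ}
    (h : InWeightedH1 ψ) {c : ℝ} (hc : ∫ x, energyDensity Ω ψ x ≤ c) :
    (∀ i, ∫⁻ x, ‖weakPartial i ψ x‖ₑ ^ 2 ≤ ENNReal.ofReal (((1 - Ω) / 2)⁻¹ * c)) ∧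
      ∀ i : Fin 2, ∫⁻ x : Plane, ‖(x i : ℂ) * ψ x‖ₑ ^ 2 ≤ ENNReal.ofReal (((1 - Ω) / 2)⁻¹ * c) := by
  have hp : 0 < (1 - Ω) / 2 := by linarith [hΩ.2]
  have hb := (h.integral_bound hΩ).trans hc
  rw [← le_inv_mul_iff₀ hp] at hb
  have n0 : 0 ≤ ∫ x, ‖weakPartial 0 ψ x‖ ^ 2 := integral_nonneg fun x => by positivity
  have n1 : 0 ≤ ∫ x, ‖weakPartial 1 ψ x‖ ^ 2 := integral_nonneg fun x => by positivity
  have n2 : 0 ≤ ∫ x : Plane, ‖(x 0 : ℂ) * ψ x‖ ^ 2 := integral_nonneg fun x => by positivity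
  have n3 : 0 ≤ ∫ x : Plane, ‖(x 1 : ℂ) * ψ x‖ ^ 2 := integral_nonneg fun x => by positivity
  constructor <;> intro i
  · rw [lintegral_sq_enorm_eq (h.memLp_partial i)]
    refine ENNReal.ofReal_le_ofReal ?_
    fin_cases i <;> simp only [Fin.zero_eta, Fin.mk_one] <;> linarith
  · rw [lintegral_sq_enorm_eq (h.memLp_coord i)]
    refine ENNReal.ofReal_le_ofReal ?_
    fin_cases i <;> simp only [Fin.zero_eta, Fin.mk_one] <;> linarith

/-- Sequences with bounded energy and bounded `L²` norm have weak limits in the weighted space,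
componentwise along a subsequence. -/
lemma exists_subseq_weakTendsto {ψ : ℕ → Plane → ℂ} (h : ∀ n, InWeightedH1 (ψ n)) {C : ℝ≥0∞}
    (hC : C ≠ ⊤) (b : ∀ n, ∫⁻ x, ‖ψ n x‖ₑ ^ 2 ≤ C)
    (bp : ∀ i n, ∫⁻ x, ‖weakPartial i (ψ n) x‖ₑ ^ 2 ≤ C)
    (bx : ∀ (i : Fin 2) n, ∫⁻ x : Plane, ‖(x i : ℂ) * ψ n x‖ₑ ^ 2 ≤ C) :
    ∃ φ : ℕ → ℕ, StrictMono φ ∧ ∃ ψ', InWeightedH1 ψ' ∧ WeakTendsto (fun n => ψ (φ n)) ψ' ∧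
      (∀ i, WeakTendsto (fun n => weakPartial i (ψ (φ n))) (weakPartial i ψ')) ∧
      ∀ i : Fin 2, WeakTendsto (fun n (x : Plane) => (x i : ℂ) * ψ (φ n) x)
        (fun x => (x i : ℂ) * ψ' x) := by
  obtain ⟨φ₁, m₁, ψ', hψ', w⟩ := exists_weakTendsto_subseq (fun n => (h n).memLp) hC b
  obtain ⟨φ₂, m₂, g₀, hg₀, w₀⟩ := exists_weakTendsto_subseq
    (fun n => (h (φ₁ n)).memLp_partial 0) hC fun n => bp 0 _
  obtain ⟨φ₃, m₃, g₁, hg₁, w₁⟩ := exists_weakTendsto_subseq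
    (fun n => (h (φ₁ (φ₂ n))).memLp_partial 1) hC fun n => bp 1 _
  obtain ⟨φ₄, m₄, k₀, hk₀, v₀⟩ := exists_weakTendsto_subseq
    (fun n => (h (φ₁ (φ₂ (φ₃ n)))).memLp_coord 0) hC fun n => bx 0 _
  obtain ⟨φ₅, m₅, k₁, hk₁, v₁⟩ := exists_weakTendsto_subseq
    (fun n => (h (φ₁ (φ₂ (φ₃ (φ₄ n))))).memLp_coord 1) hC fun n => bx 1 _
  have w' := (((w.comp m₂).comp m₃).comp m₄).comp m₅
  have w₀' := ((w₀.comp m₃).comp m₄).comp m₅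
  have w₁' := (w₁.comp m₄).comp m₅
  have v₀' := v₀.comp m₅
  -- The five weak limits were extracted independently; they are now identified as the derivatives
  -- and moments of the single function `ψ'`.
  have p₀ := w'.hasWeakPartial (fun n => (h _).hasWeakPartial 0) w₀' hg₀
  have p₁ := w'.hasWeakPartial (fun n => (h _).hasWeakPartial 1) w₁' hg₁
  have e₀ := w'.ae_eq_coord_mul hψ' v₀' hk₀
  have e₁ := w'.ae_eq_coord_mul hψ' v₁ hk₁
  have hcongr : ∀ {f : ℕ → Plane → ℂ} {g g' : Plane → ℂ}, g =ᵐ[volume] g' → WeakTendsto f g →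
      WeakTendsto f g' := by
    intro f g g' hgg hf k hk
    have : ∫ x, k x * g x = ∫ x, k x * g' x :=
      integral_congr_ae (by filter_upwards [hgg] with x hx; rw [hx])
    rw [← this]
    exact hf k hk
  have hmem : InWeightedH1 ψ' := by
    refine .mk' (g := ![g₀, g₁]) hψ' ?_ ?_ ?_ <;> intro i <;> fin_cases i
    exacts [p₀, p₁, hg₀, hg₁, (memLp_congr_ae e₀).1 hk₀, (memLp_congr_ae e₁).1 hk₁]
  refine ⟨fun n => φ₁ (φ₂ (φ₃ (φ₄ (φ₅ n)))), m₁.comp (m₂.comp (m₃.comp (m₄.comp m₅))), ψ', hmem, w',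
    ?_, ?_⟩ <;> intro i <;> fin_cases i
  exacts [hcongr p₀.weakPartial_ae_eq.symm w₀', hcongr p₁.weakPartial_ae_eq.symm w₁',
    hcongr e₀ v₀', hcongr e₁ v₁]

/-- The energy is weakly lower semicontinuous. -/
lemma energy_le_of_weakTendsto {Ω : ℝ} (hΩ : Ω ∈ Ico (0 : ℝ) 1) {ψ : ℕ → Plane → ℂ}
    {ψ' : Plane → ℂ} (h : ∀ n, InWeightedH1 (ψ n)) (h' : InWeightedH1 ψ')
    (hp : ∀ i, WeakTendsto (fun n => weakPartial i (ψ n)) (weakPartial i ψ'))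
    (hx : ∀ i : Fin 2, WeakTendsto (fun n (x : Plane) => (x i : ℂ) * ψ n x)
        (fun x => (x i : ℂ) * ψ' x)) {e : ℝ}
    (he : Tendsto (fun n => ∫ x, energyDensity Ω (ψ n) x) atTop (𝓝 e)) :
    ∫ x, energyDensity Ω ψ' x ≤ e := by
  have hΩ2 : 0 ≤ (1 - Ω ^ 2) / 2 := by nlinarith [hΩ.1, hΩ.2]
  have d₀ : WeakTendsto (fun n => covDeriv₀ Ω (ψ n)) (covDeriv₀ Ω ψ') :=
    (hp 0).add ((hx 1).const_mul _) (fun n => (h n).memLp_partial 0)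
      (fun n => ((h n).memLp_coord 1).const_mul _) (h'.memLp_partial 0)
      ((h'.memLp_coord 1).const_mul _)
  have d₁ : WeakTendsto (fun n => covDeriv₁ Ω (ψ n)) (covDeriv₁ Ω ψ') :=
    (hp 1).add ((hx 0).const_mul _) (fun n => (h n).memLp_partial 1)
      (fun n => ((h n).memLp_coord 0).const_mul _) (h'.memLp_partial 1)
      ((h'.memLp_coord 0).const_mul _)
  rw [h'.integral_energyDensity]
  -- Each squared norm is replaced by its affine minorant at the weak limit; the minorants converge
  -- to the energy of `ψ'`.
  refine le_of_tendsto_of_tendsto'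
    (((((d₀.lower_bound_tendsto (h'.memLp_covDeriv₀ Ω)).const_mul (1 / 2)).add
      ((d₁.lower_bound_tendsto (h'.memLp_covDeriv₁ Ω)).const_mul (1 / 2))).add
      (((hx 0).lower_bound_tendsto (h'.memLp_coord 0)).const_mul ((1 - Ω ^ 2) / 2))).add
      (((hx 1).lower_bound_tendsto (h'.memLp_coord 1)).const_mul ((1 - Ω ^ 2) / 2))) he fun n => ?_
  rw [(h n).integral_energyDensity]
  gcongr
  · exact integral_sq_norm_ge ((h n).memLp_covDeriv₀ Ω) (h'.memLp_covDeriv₀ Ω)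
  · exact integral_sq_norm_ge ((h n).memLp_covDeriv₁ Ω) (h'.memLp_covDeriv₁ Ω)
  · exact integral_sq_norm_ge ((h n).memLp_coord 0) (h'.memLp_coord 0)
  · exact integral_sq_norm_ge ((h n).memLp_coord 1) (h'.memLp_coord 1)

/-- Sets of bounded energy and bounded `L²` norm are sequentially compact in `L²`, and the energy is
lower semicontinuous along the extracted sequences. -/
theorem exists_subseq_tendsto {Ω : ℝ} (hΩ : Ω ∈ Ico (0 : ℝ) 1) {ψ : ℕ → Plane → ℂ}
    (h : ∀ n, InWeightedH1 (ψ n)) {c : ℝ} (hE : ∀ n, ∫ x, energyDensity Ω (ψ n) x ≤ c)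
    (hN : ∀ n, lpNorm (ψ n) 2 volume ^ 2 ≤ c) :
    ∃ φ : ℕ → ℕ, StrictMono φ ∧ ∃ ψ', InWeightedH1 ψ' ∧
      (∃ e, Tendsto (fun n => ∫ x, energyDensity Ω (ψ (φ n)) x) atTop (𝓝 e) ∧
        ∫ x, energyDensity Ω ψ' x ≤ e) ∧
      Tendsto (fun n => lpNorm (ψ (φ n)) 2 volume) atTop (𝓝 (lpNorm ψ' 2 volume)) ∧
      ∀ᵐ x, Tendsto (fun n => ψ (φ n) x) atTop (𝓝 (ψ' x)) := by
  let C : ℝ≥0∞ := max (ENNReal.ofReal c) (ENNReal.ofReal (((1 - Ω) / 2)⁻¹ * c))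
  have hC : C ≠ ⊤ := by simp [C]
  have b : ∀ n, ∫⁻ x, ‖ψ n x‖ₑ ^ 2 ≤ C := fun n => by
    rw [lintegral_sq_enorm_eq (h n).memLp, ← lpNorm_two_sq (h n).memLp]
    exact (ENNReal.ofReal_le_ofReal (hN n)).trans (le_max_left _ _)
  have bp : ∀ i n, ∫⁻ x, ‖weakPartial i (ψ n) x‖ₑ ^ 2 ≤ C := fun i n =>
    (((h n).lintegral_bounds hΩ (hE n)).1 i).trans (le_max_right _ _)
  have bx : ∀ (i : Fin 2) n, ∫⁻ x : Plane, ‖(x i : ℂ) * ψ n x‖ₑ ^ 2 ≤ C := fun i n =>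
    (((h n).lintegral_bounds hΩ (hE n)).2 i).trans (le_max_right _ _)
  obtain ⟨φ₁, m₁, ψ', h', w, wp, wx⟩ := exists_subseq_weakTendsto h hC b bp bx
  have hs := tendsto_eLpNorm_sub_of_weakTendsto (fun n => h (φ₁ n)) h' hC (fun n => b _)
    (fun i n => bp i _) (fun i n => bx i _) w
  obtain ⟨φ₂, m₂, hae⟩ := (tendstoInMeasure_of_tendsto_eLpNorm (by norm_num)
    (fun n => (h (φ₁ n)).memLp.1) h'.memLp.1 hs).exists_seq_tendsto_ae
  have hE0 : ∀ n, 0 ≤ ∫ x, energyDensity Ω (ψ n) x := fun n =>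
    integral_nonneg fun x => energyDensity_nonneg hΩ _ x
  -- The energies lie in `[0, c]`, so a last extraction makes them converge; only an inequality
  -- between their limit and the energy of `ψ'` is claimed.
  obtain ⟨e, -, φ₃, m₃, he⟩ := isCompact_Icc.tendsto_subseq
    (x := fun n => ∫ x, energyDensity Ω (ψ (φ₁ (φ₂ n))) x) (s := Icc 0 c)
    fun n => ⟨hE0 _, hE _⟩
  refine ⟨fun n => φ₁ (φ₂ (φ₃ n)), m₁.comp (m₂.comp m₃), ψ', h', ⟨e, he, ?_⟩, ?_, ?_⟩
  · exact energy_le_of_weakTendsto hΩ (fun n => h _) h' (fun i => ((wp i).comp m₂).comp m₃)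
      (fun i => ((wx i).comp m₂).comp m₃) he
  · have hs' : Tendsto (fun n => lpNorm (ψ (φ₁ n) - ψ') 2 volume) atTop (𝓝 0) := by
      have := (ENNReal.tendsto_toReal ENNReal.zero_ne_top).comp hs
      rw [ENNReal.toReal_zero] at this
      exact this.congr fun n => toReal_eLpNorm ((h _).memLp.sub h'.memLp).1
    have hn : Tendsto (fun n => lpNorm (ψ (φ₁ n)) 2 volume) atTop (𝓝 (lpNorm ψ' 2 volume)) := by
      rw [tendsto_iff_dist_tendsto_zero]
      refine squeeze_zero (fun n => dist_nonneg) (fun n => ?_) hs'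
      rw [Real.dist_eq, abs_le]
      have t1 := lpNorm_le_lpNorm_add_lpNorm_sub' (f := ψ (φ₁ n)) h'.memLp one_le_two
      have t2 := lpNorm_le_lpNorm_add_lpNorm_sub (f := ψ') (h (φ₁ n)).memLp one_le_two
      constructor <;> linarith
    exact hn.comp (m₂.comp m₃).tendsto_atTop
  · filter_upwards [hae] with x hx using hx.comp m₃.tendsto_atTop

/-! ### Scaling, and the bottom of the spectrum -/

lemma lpNorm_ofReal_mul {t : ℝ} (ht : 0 ≤ t) (ψ : Plane → ℂ) (p : ℝ≥0∞) :
    lpNorm (fun x => (t : ℂ) * ψ x) p volume = t * lpNorm ψ p volume := by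
  have h := lpNorm_const_smul (p := p) (t : ℂ) ψ volume
  rw [show (‖(t : ℂ)‖₊ : ℝ) = t by simp [abs_of_nonneg ht]] at h
  exact h

lemma freeEnergy_ofReal_mul {ψ : Plane → ℂ} (h : InWeightedH1 ψ) (Ω g lam : ℝ) {t : ℝ}
    (ht : 0 ≤ t) :
    freeEnergy Ω g lam (fun x => (t : ℂ) * ψ x) = t ^ 2 * (∫ x, energyDensity Ω ψ x)
      + g / 2 * (t ^ 4 * lpNorm ψ 4 volume ^ 4)
      + (1 / 2) * (t ^ 2 * lpNorm ψ 2 volume ^ 2 - lam) ^ 2 := by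
  rw [freeEnergy, h.integral_energyDensity_const_mul, lpNorm_ofReal_mul ht, lpNorm_ofReal_mul ht,
    mul_pow, mul_pow]

lemma InWeightedH1.exists_normalized {ψ : Plane → ℂ} (h : InWeightedH1 ψ)
    (h0 : lpNorm ψ 2 volume ≠ 0) : ∃ t : ℝ, t = (lpNorm ψ 2 volume)⁻¹ ∧
      InWeightedH1 (fun x => (t : ℂ) * ψ x) ∧ lpNorm (fun x => (t : ℂ) * ψ x) 2 volume = 1 := by
  refine ⟨_, rfl, h.const_mul _, ?_⟩
  rw [lpNorm_ofReal_mul (inv_nonneg.2 lpNorm_nonneg), inv_mul_cancel₀ h0]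

lemma exists_inWeightedH1_lpNorm_eq_one : ∃ ψ, InWeightedH1 ψ ∧ lpNorm ψ 2 volume = 1 := by
  let f : ContDiffBump (0 : Plane) := ⟨1, 2, one_pos, one_lt_two⟩
  let ψ : Plane → ℂ := fun x => (f x : ℂ)
  have hc : ContDiff ℝ 1 ψ := Complex.ofRealCLM.contDiff.comp f.contDiff
  have h : InWeightedH1 ψ := .of_contDiff hc
    (f.hasCompactSupport.comp_left (g := Complex.ofReal) (by simp))
  have h0 : lpNorm ψ 2 volume ≠ 0 := by
    rw [Ne, lpNorm_eq_zero h.memLp (by norm_num)]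
    intro hz
    have := (hc.continuous.ae_eq_iff_eq volume continuous_zero).1 hz
    have h1 : ψ 0 = 0 := congrFun this 0
    have h2 : f 0 = 1 := f.one_of_mem_closedBall (by simp [f])
    simp [ψ, h2] at h1
  obtain ⟨t, -, ht, ht'⟩ := h.exists_normalized h0
  exact ⟨_, ht, ht'⟩

variable {Ω : ℝ}

lemma integral_energyDensity_nonneg (hΩ : Ω ∈ Ico (0 : ℝ) 1) (ψ : Plane → ℂ) :
    0 ≤ ∫ x, energyDensity Ω ψ x :=
  integral_nonneg fun x => energyDensity_nonneg hΩ ψ x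

/-- Zero energy makes both moments `x i * ψ` vanish, so `ψ` is zero away from the origin, a null
set. -/
lemma integral_energyDensity_pos (hΩ : Ω ∈ Ico (0 : ℝ) 1) {ψ : Plane → ℂ} (h : InWeightedH1 ψ)
    (h0 : lpNorm ψ 2 volume ≠ 0) : 0 < ∫ x, energyDensity Ω ψ x := by
  refine lt_of_le_of_ne (integral_energyDensity_nonneg hΩ ψ) fun hE => h0 ?_
  have hb := (h.lintegral_bounds hΩ hE.symm.le).2
  have hz : ∀ i : Fin 2, ∀ᵐ x : Plane, (x i : ℂ) * ψ x = 0 := by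
    intro i
    have hi := hb i
    simp only [mul_zero, ENNReal.ofReal_zero, nonpos_iff_eq_zero] at hi
    rw [lintegral_eq_zero_iff' ((h.memLp_coord i).1.enorm.pow_const 2)] at hi
    filter_upwards [hi] with x hx
    simpa using hx
  rw [lpNorm_eq_zero h.memLp (by norm_num)]
  filter_upwards [hz 0, hz 1, compl_mem_ae_iff.2 (measure_singleton (μ := volume) (0 : Plane))]
    with x hx0 hx1 hx
  by_contra hne
  refine hx ?_
  have e0 : x 0 = 0 := by simpa [show ψ x ≠ 0 from hne] using hx0
  have e1 : x 1 = 0 := by simpa [show ψ x ≠ 0 from hne] using hx1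
  ext i
  fin_cases i
  exacts [e0, e1]

lemma muMin_le (hΩ : Ω ∈ Ico (0 : ℝ) 1) {ψ : Plane → ℂ} (h : InWeightedH1 ψ)
    (h1 : lpNorm ψ 2 volume = 1) : muMin Ω ≤ ∫ x, energyDensity Ω ψ x := by
  refine csInf_le ⟨0, ?_⟩ ⟨ψ, (mem_formDomain_iff hΩ).2 h, h1, rfl⟩
  rintro r ⟨φ, -, -, rfl⟩
  exact integral_energyDensity_nonneg hΩ φ

/-- The bottom of the spectrum is attained. -/
lemma exists_integral_energyDensity_eq_muMin (hΩ : Ω ∈ Ico (0 : ℝ) 1) :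
    ∃ ψ, InWeightedH1 ψ ∧ lpNorm ψ 2 volume = 1 ∧ ∫ x, energyDensity Ω ψ x = muMin Ω := by
  obtain ⟨ψ₀, hψ₀, hn₀⟩ := exists_inWeightedH1_lpNorm_eq_one
  obtain ⟨u, hu, hlim, hmem⟩ := exists_seq_tendsto_sInf
    (S := {r : ℝ | ∃ ψ ∈ formDomain Ω, lpNorm ψ 2 volume = 1 ∧ r = ∫ x, energyDensity Ω ψ x})
    ⟨_, ψ₀, (mem_formDomain_iff hΩ).2 hψ₀, hn₀, rfl⟩
    ⟨0, by rintro r ⟨φ, -, -, rfl⟩; exact integral_energyDensity_nonneg hΩ φ⟩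
  choose ψ hψ hn hE using hmem
  have hψ' := fun n => (mem_formDomain_iff hΩ).1 (hψ n)
  obtain ⟨φ, hφ, ψ', h', ⟨e, he, hle⟩, hN, -⟩ := exists_subseq_tendsto hΩ hψ' (c := max (u 0) 1)
    (fun n => (hE n).symm.le.trans ((hu (Nat.zero_le n)).trans (le_max_left _ _)))
    (fun n => by rw [hn, one_pow]; exact le_max_right _ _)
  simp_rw [← hE] at he
  have hee : e = muMin Ω := tendsto_nhds_unique he (hlim.comp hφ.tendsto_atTop)
  simp_rw [hn] at hN
  -- No mass is lost in the limit, because the convergence in `L²` is strong.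
  have h1 : lpNorm ψ' 2 volume = 1 := (tendsto_nhds_unique tendsto_const_nhds hN).symm
  exact ⟨ψ', h', h1, le_antisymm (hle.trans hee.le) (muMin_le hΩ h' h1)⟩

lemma muMin_pos (hΩ : Ω ∈ Ico (0 : ℝ) 1) : 0 < muMin Ω := by
  obtain ⟨ψ, h, h1, hE⟩ := exists_integral_energyDensity_eq_muMin hΩ
  rw [← hE]
  exact integral_energyDensity_pos hΩ h (by simp [h1])

lemma muMin_mul_le (hΩ : Ω ∈ Ico (0 : ℝ) 1) {ψ : Plane → ℂ} (h : InWeightedH1 ψ) :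
    muMin Ω * lpNorm ψ 2 volume ^ 2 ≤ ∫ x, energyDensity Ω ψ x := by
  by_cases h0 : lpNorm ψ 2 volume = 0
  · rw [h0]; simpa using integral_energyDensity_nonneg hΩ ψ
  · obtain ⟨t, rfl, ht, ht1⟩ := h.exists_normalized h0
    have := muMin_le hΩ ht ht1
    rw [h.integral_energyDensity_const_mul, inv_pow] at this
    rwa [le_inv_mul_iff₀ (by positivity), mul_comm] at this

/-! ### Minimizers of the free energy -/

lemma exists_isMinOn_freeEnergy (hΩ : Ω ∈ Ico (0 : ℝ) 1) {g : ℝ} (hg : 0 ≤ g) (lam : ℝ) :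
    ∃ ψ ∈ formDomain Ω, IsMinOn (freeEnergy Ω g lam) (formDomain Ω) ψ := by
  have hQ : ∀ ψ : Plane → ℂ, 0 ≤ g / 2 * lpNorm ψ 4 volume ^ 4 := fun ψ => by
    have := lpNorm_nonneg (f := ψ) (p := 4) (μ := volume)
    positivity
  have hF0 : ∀ ψ, 0 ≤ freeEnergy Ω g lam ψ := fun ψ =>
    add_nonneg (add_nonneg (integral_energyDensity_nonneg hΩ ψ) (hQ ψ)) (by positivity)
  have hbdd : BddBelow (freeEnergy Ω g lam '' formDomain Ω) :=
    ⟨0, by rintro _ ⟨φ, -, rfl⟩; exact hF0 φ⟩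
  obtain ⟨ψ₀, hψ₀, -⟩ := exists_inWeightedH1_lpNorm_eq_one
  obtain ⟨u, hu, hlim, hmem⟩ := exists_seq_tendsto_sInf
    (S := freeEnergy Ω g lam '' formDomain Ω) ⟨_, ψ₀, (mem_formDomain_iff hΩ).2 hψ₀, rfl⟩ hbdd
  set m := sInf (freeEnergy Ω g lam '' formDomain Ω)
  choose ψ hψ hF using hmem
  have hψ' := fun n => (mem_formDomain_iff hΩ).1 (hψ n)
  have hFu : ∀ n, (∫ x, energyDensity Ω (ψ n) x) + g / 2 * lpNorm (ψ n) 4 volume ^ 4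
      + (1 / 2) * (lpNorm (ψ n) 2 volume ^ 2 - lam) ^ 2 = u n := hF
  have hu0 : ∀ n, u n ≤ u 0 := fun n => hu (Nat.zero_le n)
  obtain ⟨φ, hφ, ψ', h', ⟨e, he, hle⟩, hN, hae⟩ := exists_subseq_tendsto hΩ hψ'
    -- The values bound the energy by `u 0` and `½(N - λ)²` by `u 0`. From `y ≤ ½y² + ½` follows `N
    -- ≤ λ + u 0 + 1`, so the bracket is nonnegative even for negative `λ`, and one constant serves
    -- both bounds.
    (c := u 0 + (u 0 + lam + 1))
    (fun n => by
      have h1 := hFu n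
      have h2 := hu0 n
      have h3 := hQ (ψ n)
      have h4 := hu0 0
      have h5 : 0 ≤ u 0 := (hF 0) ▸ hF0 _
      have h6 := integral_energyDensity_nonneg hΩ (ψ n)
      nlinarith [sq_nonneg (lpNorm (ψ n) 2 volume ^ 2 - lam + 1),
        sq_nonneg (lpNorm (ψ n) 2 volume), sq_nonneg (lpNorm (ψ n) 2 volume ^ 2 - lam)])
    (fun n => by
      have h1 := hFu n
      have h2 := hu0 n
      have h3 := hQ (ψ n)
      have h5 : 0 ≤ u 0 := (hF 0) ▸ hF0 _
      have h6 := integral_energyDensity_nonneg hΩ (ψ n)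
      nlinarith [sq_nonneg (lpNorm (ψ n) 2 volume ^ 2 - lam - 1)])
  refine ⟨ψ', (mem_formDomain_iff hΩ).2 h', fun χ hχ => ?_⟩
  refine le_trans ?_ (csInf_le hbdd ⟨χ, hχ, rfl⟩)
  -- The total, the energy and the penalty all converge, so the quartic term converges as well; its
  -- limit `q` is what Fatou must be compared with.
  have hq : Tendsto (fun n => g / 2 * lpNorm (ψ (φ n)) 4 volume ^ 4) atTop
      (𝓝 (m - e - (1 / 2) * (lpNorm ψ' 2 volume ^ 2 - lam) ^ 2)) := by
    refine (((hlim.comp hφ.tendsto_atTop).sub he).sub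
      ((((hN.pow 2).sub_const lam).pow 2).const_mul (1 / 2))).congr fun n => ?_
    simp only [Function.comp_apply, ← hFu]
    ring
  set q := m - e - (1 / 2) * (lpNorm ψ' 2 volume ^ 2 - lam) ^ 2 with hq_def
  have hq0 : 0 ≤ q := ge_of_tendsto' hq fun n => hQ _
  have hfatou : g / 2 * lpNorm ψ' 4 volume ^ 4 ≤ q := by
    -- For `g = 0` the term vanishes; otherwise division by `g / 2` turns `q` into the limit of the
    -- quartic integrals.
    rcases hg.eq_or_lt with rfl | hg
    · simpa using hq0
    · have hQlim : Tendsto (fun n => ∫⁻ x, ‖ψ (φ n) x‖ₑ ^ 4) atTop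
          (𝓝 (ENNReal.ofReal ((g / 2)⁻¹ * q))) := by
        simp_rw [lintegral_pow_four_enorm_eq (hψ' _).memLp_four]
        refine (ENNReal.continuous_ofReal.tendsto _).comp ((hq.const_mul (g / 2)⁻¹).congr fun n => ?_)
        field_simp
      have hf := lintegral_pow_enorm_le_liminf (fun n => (hψ' (φ n)).memLp.1) hae 4
      rw [hQlim.liminf_eq, lintegral_pow_four_enorm_eq h'.memLp_four,
        ENNReal.ofReal_le_ofReal_iff (by positivity), le_inv_mul_iff₀ (by positivity)] at hf
      exact hf
  rw [freeEnergy]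
  linarith

/-- The virial identity for a minimizer, from varying it along its ray. -/
lemma virial_of_isMinOn (hΩ : Ω ∈ Ico (0 : ℝ) 1) {g lam : ℝ} {ψ : Plane → ℂ} (h : InWeightedH1 ψ)
    (hmin : IsMinOn (freeEnergy Ω g lam) (formDomain Ω) ψ) :
    (∫ x, energyDensity Ω ψ x) + g * lpNorm ψ 4 volume ^ 4
      + (lpNorm ψ 2 volume ^ 2 - lam) * lpNorm ψ 2 volume ^ 2 = 0 := by
  set E := ∫ x, energyDensity Ω ψ x with hE
  set Q := lpNorm ψ 4 volume ^ 4 with hQ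
  set N := lpNorm ψ 2 volume ^ 2 with hN
  let p : ℝ → ℝ := fun t => t ^ 2 * E + g / 2 * (t ^ 4 * Q) + (1 / 2) * (t ^ 2 * N - lam) ^ 2
  have hp : IsLocalMin p 1 := by
    filter_upwards [lt_mem_nhds (zero_lt_one (α := ℝ))] with t ht
    have h1 := hmin ((mem_formDomain_iff hΩ).2 (h.const_mul t))
    simp only [mem_ofPred_eq] at h1
    rw [freeEnergy_ofReal_mul h Ω g lam ht.le] at h1
    simpa [p, freeEnergy] using h1
  have hd : HasDerivAt p (2 * (E + g * Q + (N - lam) * N)) 1 := by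
    have h2 : HasDerivAt (fun t : ℝ => t ^ 2) 2 1 := by simpa using hasDerivAt_pow 2 (1 : ℝ)
    have h4 : HasDerivAt (fun t : ℝ => t ^ 4) 4 1 := by simpa using hasDerivAt_pow 4 (1 : ℝ)
    have := ((h2.mul_const E).add ((h4.mul_const Q).const_mul (g / 2))).add
      ((((h2.mul_const N).sub_const lam).pow 2).const_mul (1 / 2))
    refine this.congr_deriv ?_
    simp
    ring
  have := hp.hasDerivAt_eq_zero hd
  linarith

lemma integral_energyDensity_pos_of_isMinOn (hΩ : Ω ∈ Ico (0 : ℝ) 1) {g lam : ℝ} (hg : 0 ≤ g)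
    (hlam : muMin Ω < lam) {ψ : Plane → ℂ} (h : InWeightedH1 ψ)
    (hmin : IsMinOn (freeEnergy Ω g lam) (formDomain Ω) ψ) : 0 < ∫ x, energyDensity Ω ψ x := by
  refine integral_energyDensity_pos hΩ h fun h0 => ?_
  obtain ⟨χ, hχ, hχ1, hχE⟩ := exists_integral_energyDensity_eq_muMin hΩ
  have hQ : 0 ≤ lpNorm χ 4 volume ^ 4 := pow_nonneg lpNorm_nonneg 4
  set Q := lpNorm χ 4 volume ^ 4
  have hD : 0 < g * Q + 1 := by positivity
  -- This `s` minimizes `s μ_min + ½gQs² + ½(s - λ)²`, the free energy of `√s χ`. Its value there is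
  -- `λ²/2 - ½s(λ - μ_min)`, strictly below the `λ²/2` that any function of zero `L²` norm costs.
  set s := (lam - muMin Ω) / (g * Q + 1) with hs
  have hs0 : 0 < s := div_pos (by linarith) hD
  have hsD : s * (g * Q + 1) = lam - muMin Ω := div_mul_cancel₀ _ hD.ne'
  have h1 := hmin ((mem_formDomain_iff hΩ).2 (hχ.const_mul (Real.sqrt s)))
  simp only [mem_ofPred_eq] at h1
  have h4 : Real.sqrt s ^ 4 = s ^ 2 := by
    rw [show (4 : ℕ) = 2 * 2 from rfl, pow_mul, Real.sq_sqrt hs0.le]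
  rw [freeEnergy_ofReal_mul hχ Ω g lam (Real.sqrt_nonneg s), h4, Real.sq_sqrt hs0.le, hχ1, hχE,
    freeEnergy, h0] at h1
  have hEψ := integral_energyDensity_nonneg hΩ ψ
  have hQψ : 0 ≤ g / 2 * lpNorm ψ 4 volume ^ 4 := by
    have := lpNorm_nonneg (f := ψ) (p := 4) (μ := volume)
    positivity
  have h2 : s * (s * (g * Q + 1)) = s * (lam - muMin Ω) := by rw [hsD]
  nlinarith [mul_pos hs0 (sub_pos.2 hlam)]

end RotatingBEC

theorem theorem1 (Ω g lam : ℝ) (hΩ : Ω ∈ Set.Ico (0 : ℝ) 1) (hg : 0 ≤ g) :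
    -- `A_Ω ≥ μ_min > 0`
    (0 < RotatingBEC.muMin Ω ∧
      ∀ ψ ∈ RotatingBEC.formDomain Ω,
        RotatingBEC.muMin Ω * lpNorm ψ 2 volume ^ 2 ≤ ∫ x, RotatingBEC.energyDensity Ω ψ x) ∧
    -- `H_Ω ⊆ L⁴`, so that `F` is finite on all of `H_Ω`
    (∀ ψ ∈ RotatingBEC.formDomain Ω, MemLp ψ 4 volume) ∧
    -- `F` has an absolute minimizer on `H_Ω`
    (∃ ψ ∈ RotatingBEC.formDomain Ω,
      IsMinOn (RotatingBEC.freeEnergy Ω g lam) (RotatingBEC.formDomain Ω) ψ) ∧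
    -- every absolute minimizer lies in the stated set
    (RotatingBEC.muMin Ω < lam →
      ∀ ψ ∈ RotatingBEC.formDomain Ω,
        IsMinOn (RotatingBEC.freeEnergy Ω g lam) (RotatingBEC.formDomain Ω) ψ →
          0 < RotatingBEC.omegaNorm Ω ψ ^ 2 ∧
          RotatingBEC.omegaNorm Ω ψ ^ 2 ≤ lam * lpNorm ψ 2 volume ^ 2 ∧
          lam * lpNorm ψ 2 volume ^ 2 ≤ lam * (lam - RotatingBEC.muMin Ω)) := by
  have hiff := fun ψ => RotatingBEC.mem_formDomain_iff (ψ := ψ) hΩ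
  have hpos := RotatingBEC.muMin_pos hΩ
  refine ⟨⟨hpos, fun ψ hψ => RotatingBEC.muMin_mul_le hΩ ((hiff ψ).1 hψ)⟩,
    fun ψ hψ => ((hiff ψ).1 hψ).memLp_four, RotatingBEC.exists_isMinOn_freeEnergy hΩ hg lam,
    fun hlam ψ hψ hmin => ?_⟩
  have h := (hiff ψ).1 hψ
  have hE := RotatingBEC.integral_energyDensity_pos_of_isMinOn hΩ hg hlam h hmin
  have hv := RotatingBEC.virial_of_isMinOn hΩ h hmin
  have hle := RotatingBEC.muMin_mul_le hΩ h
  have hQ : 0 ≤ g * lpNorm ψ 4 volume ^ 4 := mul_nonneg hg (pow_nonneg lpNorm_nonneg 4)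
  rw [RotatingBEC.omegaNorm, Real.sq_sqrt hE.le]
  have hN0 : 0 ≤ lpNorm ψ 2 volume ^ 2 := sq_nonneg _
  generalize lpNorm ψ 2 volume ^ 2 = N at *
  -- If `N = 0`, the virial identity reads `E = -gQ ≤ 0`, against `E > 0`.
  have hN : 0 < N := by
    refine lt_of_le_of_ne hN0 fun h0 => ?_
    rw [← h0] at hv
    linarith
  -- The virial identity gives `μ_min N ≤ E ≤ (λ - N)N`; the positive factor `N` cancels.
  have hNle : N ≤ lam - RotatingBEC.muMin Ω := by
    refine le_of_mul_le_mul_right ?_ hN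
    linarith
  exact ⟨hE, by nlinarith, mul_le_mul_of_nonneg_left hNle (hpos.trans hlam).le⟩
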